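/- **Theorem.** Let $d,\ell\ge 0$ be integers, $p\ge 1$ a real number with integer part $N=[p]$, $\gamma>p$ and $T\ge 0$. A map $g$ between finite-dimensional normed spaces is said to be of class $C^\gamma$ if, $k$ being the largest integer strictly less than $\gamma$, it is $k$ times continuously differentiable and its $k$-th derivative is locally $(\gamma-k)$-Hölder continuous (no boundedness is required). Let $V_1,\dots,V_\ell$ be vector fields on $\mathbb{R}^d$ of class $C^\gamma$. For a differentiable map $g$ on $\mathbb{R}^d$ write $(V_ig)(x)=(D_xg)(V_i(x))$, and for a word $I=(i_1,\dots,i_k)\in\{1,\dots,\ell\}^k$ put $|I|=k$ and $V_I=V_{i_1}\cdots V_{i_k}$, that is $V_Ig=V_{i_1}(\cdots(V_{i_k}g))$. Let $T^N_\ell=\bigoplus_{i=0}^N(\mathbb{R}^\ell)^{\otimes i}$ be the truncated tensor algebra, with coordinates $(a^I)_{|I|\le N}$ in the canonical basis and level $i$ components $a^i$, and set $\|a\|=\sum_{i=1}^N|a^i|^{1/i}$, with $|\cdot|$ the Euclidean norm. Let $\mathfrak{g}^N_\ell$ be the Lie algebra generated by $\mathbb{R}^\ell$ in $T^N_\ell$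 (with bracket $[a,b]=ab-ba$) and $G^N_\ell=\exp(\mathfrak{g}^N_\ell)$. Let $\mathbf{X}$ be a weak geometric Hölder $p$-rough path over $\mathbb{R}^\ell$ on $[0,T]$, that is, a path $\mathbf X:[0,T]\to G^N_\ell$ such that $\mathbf{X}_{ts}:=\mathbf{X}_s^{-1}\mathbf{X}_t$ satisfies $\|\mathbf{X}_{ts}\|\le C|t-s|^{1/p}$ for all $0\le s\le t\le T$, for some constant $C$. Let $z:[0,T]\to\mathbb{R}^d$ be a path. Then the following two statements are equivalent. 1. (*$z$ solves $dz_t=\mathrm{F}(z_t)\,d\mathbf{X}_t$, $\mathrm{F}=(V_1,\dots,V_\ell)$, in the sense of Davie.*) There are an exponent $a>1$ and a constant $C$ such that for all $0\le s\le t\le T$ $$\Big|z_t-z_s-\sum_{1\le|I|\le N}X^I_{ts}\,(V_I\mathrm{Id})(z_s)\Big|\le C|t-s|^a .$$ 2. (*$z$ solves the same equation in the sense of Bailleul.*) There is an exponent $a>1$ such that for every function $f:\mathbb{R}^d\to\mathbb{R}$ of class $C^\gamma$ there is a constant $C_f$ such that for all $0\le s\le t\le T$ $$\Big|f(z_t)-f(z_s)-\sum_{1\le|I|\le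 N}X^I_{ts}\,(V_If)(z_s)\Big|\le C_f|t-s|^a .$$ The exponents in the two statements may be different. -/

import Mathlib

noncomputable section

namespace RoughPaths

/-- The vector space underlying the truncated tensor algebra `⨁_{i ≤ N} (ℝ^ℓ)^{⊗ i}`, through
coordinates in the canonical basis: the coordinate at the word `[i₁, …, i_k]` is the coefficient of
`e_{i₁} ⊗ ⋯ ⊗ e_{i_k}`, and coordinates at words of length greater than `N` vanish. -/
def truncSubmodule (ℓ N : ℕ) : Submodule ℝ (List (Fin ℓ) → ℝ) where
  carrier := {a | ∀ w : List (Fin ℓ), N < w.length → a w = 0}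
  add_mem' := by
    intro a b ha hb w hw
    simp [ha w hw, hb w hw]
  zero_mem' := by
    intro w _
    rfl
  smul_mem' := by
    intro c a ha w hw
    simp [ha w hw]

/-- The truncated tensor algebra over `ℝ^ℓ`, with levels `0, …, N`. -/
def TruncTensor (ℓ N : ℕ) : Type := truncSubmodule ℓ N

namespace TruncTensor

variable {ℓ N : ℕ}

instance : AddCommGroup (TruncTensor ℓ N) := inferInstanceAs (AddCommGroup (truncSubmodule ℓ N))

instance : Module ℝ (TruncTensor ℓ N) := inferInstanceAs (Module ℝ (truncSubmodule ℓ N))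

/-- The coordinate of a tensor at a word. -/
def coeff (a : TruncTensor ℓ N) (w : List (Fin ℓ)) : ℝ := a.1 w

theorem coeff_eq_zero (a : TruncTensor ℓ N) {w : List (Fin ℓ)} (hw : N < w.length) :
    a.coeff w = 0 := a.2 w hw

@[ext] theorem ext {a b : TruncTensor ℓ N} (h : ∀ w, a.coeff w = b.coeff w) : a = b :=
  Subtype.ext (funext h)

@[simp] theorem coeff_add (a b : TruncTensor ℓ N) (w : List (Fin ℓ)) :
    (a + b).coeff w = a.coeff w + b.coeff w := rfl

@[simp] theorem coeff_zero (w : List (Fin ℓ)) : (0 : TruncTensor ℓ N).coeff w = 0 := rfl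

@[simp] theorem coeff_smul (c : ℝ) (a : TruncTensor ℓ N) (w : List (Fin ℓ)) :
    (c • a).coeff w = c * a.coeff w := rfl

/-- The tensor product truncated at level `N`, i.e. concatenation of words. -/
instance : Mul (TruncTensor ℓ N) where
  mul a b :=
    ⟨fun w => if w.length ≤ N then
        ∑ i ∈ Finset.range (w.length + 1), a.coeff (w.take i) * b.coeff (w.drop i)
      else 0, by
      intro w hw
      exact if_neg (not_le.mpr hw)⟩

/-- The unit: the empty word. -/
instance : One (TruncTensor ℓ N) where
  one :=
    ⟨fun w => if w = [] then 1 else 0, by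
      intro w hw
      refine if_neg ?_
      rintro rfl
      simp at hw⟩

theorem coeff_mul (a b : TruncTensor ℓ N) {w : List (Fin ℓ)} (hw : w.length ≤ N) :
    (a * b).coeff w =
      ∑ i ∈ Finset.range (w.length + 1), a.coeff (w.take i) * b.coeff (w.drop i) :=
  if_pos hw

theorem coeff_one (w : List (Fin ℓ)) :
    (1 : TruncTensor ℓ N).coeff w = if w = [] then 1 else 0 := rfl

theorem ext_of_le {a b : TruncTensor ℓ N} (h : ∀ w, w.length ≤ N → a.coeff w = b.coeff w) :
    a = b := by
  ext w
  by_cases hw : w.length ≤ N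
  · exact h w hw
  · rw [coeff_eq_zero a (not_le.mp hw), coeff_eq_zero b (not_le.mp hw)]

theorem mul_assoc' (a b c : TruncTensor ℓ N) : a * b * c = a * (b * c) := by
  refine ext_of_le fun w hw => ?_
  rw [coeff_mul _ _ hw, coeff_mul _ _ hw]
  have h1 : ∀ i ∈ Finset.range (w.length + 1),
      (a * b).coeff (w.take i) * c.coeff (w.drop i) =
        ∑ j ∈ Finset.range (i + 1),
          a.coeff (w.take j) * b.coeff ((w.take i).drop j) * c.coeff (w.drop i) := by
    intro i hi
    have hi' : i ≤ w.length := Nat.lt_succ_iff.mp (Finset.mem_range.mp hi)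
    have hl : (w.take i).length = i := by simp [hi']
    rw [coeff_mul _ _ (by omega), Finset.sum_mul, hl]
    refine Finset.sum_congr rfl fun j hj => ?_
    have hj' : j ≤ i := Nat.lt_succ_iff.mp (Finset.mem_range.mp hj)
    rw [List.take_take, min_eq_left hj']
  have h2 : ∀ j ∈ Finset.range (w.length + 1),
      a.coeff (w.take j) * (b * c).coeff (w.drop j) =
        ∑ k ∈ Finset.range (w.length - j + 1),
          a.coeff (w.take j) * (b.coeff ((w.drop j).take k) * c.coeff (w.drop (j + k))) := by
    intro j hj
    have hl : (w.drop j).length = w.length - j := by simp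
    rw [coeff_mul _ _ (by omega), Finset.mul_sum, hl]
    refine Finset.sum_congr rfl fun k _ => ?_
    rw [List.drop_drop]
  rw [Finset.sum_congr rfl h1, Finset.sum_congr rfl h2, Finset.sum_sigma', Finset.sum_sigma']
  refine Finset.sum_nbij' (fun x => ⟨x.2, x.1 - x.2⟩) (fun x => ⟨x.1 + x.2, x.1⟩) ?_ ?_ ?_ ?_ ?_
  · rintro ⟨i, j⟩ h
    simp only [Finset.mem_sigma, Finset.mem_range] at h ⊢
    omega
  · rintro ⟨i, j⟩ h
    simp only [Finset.mem_sigma, Finset.mem_range] at h ⊢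
    omega
  · rintro ⟨i, j⟩ h
    simp only [Finset.mem_sigma, Finset.mem_range] at h
    have : j + (i - j) = i := by omega
    simp [this]
  · rintro ⟨i, j⟩ _
    simp
  · rintro ⟨i, j⟩ h
    simp only [Finset.mem_sigma, Finset.mem_range] at h
    have : j + (i - j) = i := by omega
    simp only [this, List.drop_take, mul_assoc]

theorem one_mul' (a : TruncTensor ℓ N) : 1 * a = a := by
  refine ext_of_le fun w hw => ?_
  rw [coeff_mul _ _ hw, Finset.sum_eq_single 0]
  · simp [coeff_one]
  · intro i hi h0
    have : w.take i ≠ [] := by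
      intro h
      have hl := congrArg List.length h
      simp only [Finset.mem_range] at hi
      simp only [List.length_take, List.length_nil] at hl
      omega
    simp [coeff_one, this]
  · simp

theorem mul_one' (a : TruncTensor ℓ N) : a * 1 = a := by
  refine ext_of_le fun w hw => ?_
  rw [coeff_mul _ _ hw, Finset.sum_eq_single w.length]
  · simp [coeff_one]
  · intro i hi h0
    have : w.drop i ≠ [] := by
      intro h
      have hl := congrArg List.length h
      simp only [Finset.mem_range] at hi
      simp only [List.length_drop, List.length_nil] at hl
      omega
    simp [coeff_one, this]
  · simp

theorem add_mul' (a b c : TruncTensor ℓ N) : (a + b) * c = a * c + b * c := by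
  refine ext_of_le fun w hw => ?_
  simp [coeff_mul _ _ hw, add_mul, Finset.sum_add_distrib]

theorem mul_add' (a b c : TruncTensor ℓ N) : a * (b + c) = a * b + a * c := by
  refine ext_of_le fun w hw => ?_
  simp [coeff_mul _ _ hw, mul_add, Finset.sum_add_distrib]

theorem smul_mul' (r : ℝ) (a b : TruncTensor ℓ N) : (r • a) * b = r • (a * b) := by
  refine ext_of_le fun w hw => ?_
  simp [coeff_mul _ _ hw, mul_assoc, Finset.mul_sum]

theorem mul_smul' (r : ℝ) (a b : TruncTensor ℓ N) : a * (r • b) = r • (a * b) := by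
  refine ext_of_le fun w hw => ?_
  simp [coeff_mul _ _ hw, mul_left_comm, Finset.mul_sum]

theorem zero_mul' (a : TruncTensor ℓ N) : 0 * a = 0 := by
  refine ext_of_le fun w hw => ?_
  simp [coeff_mul _ _ hw]

theorem mul_zero' (a : TruncTensor ℓ N) : a * 0 = 0 := by
  refine ext_of_le fun w hw => ?_
  simp [coeff_mul _ _ hw]

instance : Ring (TruncTensor ℓ N) :=
  { (inferInstance : AddCommGroup (TruncTensor ℓ N)) with
    mul_assoc := mul_assoc'
    one_mul := one_mul'
    mul_one := mul_one'
    left_distrib := mul_add'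
    right_distrib := add_mul'
    zero_mul := zero_mul'
    mul_zero := mul_zero' }

instance : Algebra ℝ (TruncTensor ℓ N) := Algebra.ofModule smul_mul' mul_smul'

instance : LieRing (TruncTensor ℓ N) := LieRing.ofAssociativeRing

instance : LieAlgebra ℝ (TruncTensor ℓ N) := LieAlgebra.ofAssociativeAlgebra

/-- The basis vector `e_i` of `ℝ^ℓ`, seen in the truncated tensor algebra. -/
def letter (i : Fin ℓ) : TruncTensor ℓ N :=
  ⟨fun w => if w = [i] ∧ 1 ≤ N then 1 else 0, by
    intro w hw
    refine if_neg ?_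
    rintro ⟨rfl, h⟩
    simp at hw
    omega⟩

/-- The Euclidean norm of the component of level `k`. -/
def levelNorm (a : TruncTensor ℓ N) (k : ℕ) : ℝ :=
  Real.sqrt (∑ I : Fin k → Fin ℓ, a.coeff (List.ofFn I) ^ 2)

/-- The homogeneous norm `∑_{k = 1}^N |a^k|^{1/k}`. -/
def homNorm (a : TruncTensor ℓ N) : ℝ :=
  ∑ k ∈ Finset.Icc 1 N, a.levelNorm k ^ (1 / (k : ℝ))

/-- The exponential. The sum stops at `N`, since `a ^ k = 0` for `k > N` when `a` has no component
of level zero, as all elements of the Lie algebra below. -/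
def exp (a : TruncTensor ℓ N) : TruncTensor ℓ N :=
  ∑ k ∈ Finset.range (N + 1), ((k.factorial : ℝ)⁻¹) • a ^ k

end TruncTensor

/-- The `N`-step free nilpotent Lie algebra: the Lie algebra generated by `ℝ^ℓ` in the truncated
tensor algebra, with the commutator as bracket. -/
def freeNilpotentLieAlgebra (ℓ N : ℕ) : LieSubalgebra ℝ (TruncTensor ℓ N) :=
  LieSubalgebra.lieSpan ℝ (TruncTensor ℓ N) (Set.range TruncTensor.letter)

/-- The `N`-step free nilpotent Lie group: the image of the Lie algebra under the exponential. -/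
def freeNilpotentGroup (ℓ N : ℕ) : Set (TruncTensor ℓ N) :=
  TruncTensor.exp '' (freeNilpotentLieAlgebra ℓ N : Set (TruncTensor ℓ N))

/-- The increment `X_s⁻¹ X_t`. -/
def incr {ℓ N : ℕ} (X : ℝ → (TruncTensor ℓ N)ˣ) (s t : ℝ) : TruncTensor ℓ N :=
  (((X s)⁻¹ * X t : (TruncTensor ℓ N)ˣ) : TruncTensor ℓ N)

/-- Weak geometric Hölder `p`-rough paths over `ℝ^ℓ` on `[0,T]`: paths with values in the
`⌊p⌋`-step free nilpotent group that are `1/p`-Hölder. (All elements of the group are invertible in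
the truncated tensor algebra; the path is typed as a path of units so that inverses are at hand.) -/
def IsWeakGeometricRoughPath {ℓ : ℕ} (p T : ℝ) (X : ℝ → (TruncTensor ℓ ⌊p⌋₊)ˣ) : Prop :=
  (∀ t ∈ Set.Icc 0 T, (X t : TruncTensor ℓ ⌊p⌋₊) ∈ freeNilpotentGroup ℓ ⌊p⌋₊) ∧
  ∃ C : ℝ, ∀ s t : ℝ, 0 ≤ s → s ≤ t → t ≤ T →
    (incr X s t).homNorm ≤ C * |t - s| ^ (1 / p)

/-- Maps of class `C^γ`, for `γ > 0`: with `k` the largest integer strictly less than `γ`, the map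
is `k` times continuously differentiable and its `k`-th derivative is locally
`(γ - k)`-Hölder continuous. Neither the map nor its derivatives need be bounded. -/
def IsClassC {E F : Type*} [NormedAddCommGroup E] [NormedSpace ℝ E] [NormedAddCommGroup F]
    [NormedSpace ℝ F] (γ : ℝ) (g : E → F) : Prop :=
  ContDiff ℝ (⌈γ⌉₊ - 1 : ℕ) g ∧
  ∀ x : E, ∃ r > 0, ∃ C : ℝ, ∀ y ∈ Metric.ball x r, ∀ y' ∈ Metric.ball x r,
    ‖iteratedFDeriv ℝ (⌈γ⌉₊ - 1) g y - iteratedFDeriv ℝ (⌈γ⌉₊ - 1) g y'‖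
      ≤ C * ‖y - y'‖ ^ (γ - (⌈γ⌉₊ - 1 : ℕ))

/-- The differential operator `V_I = V_{i₁} ⋯ V_{i_k}` for the word `I = [i₁, …, i_k]`, where
`(V_i g)(x) = (D_x g)(V_i(x))`. -/
def diffOp {ℓ : ℕ} {E F : Type*} [NormedAddCommGroup E] [NormedSpace ℝ E] [NormedAddCommGroup F]
    [NormedSpace ℝ F] (V : Fin ℓ → E → E) : List (Fin ℓ) → (E → F) → (E → F)
  | [], g => g
  | i :: I, g => fun x => fderiv ℝ (diffOp V I g) x (V i x)

/-- The sum `∑_{1 ≤ |I| ≤ N} a^I (V_I g)(x)`. -/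
def taylorSum {ℓ N : ℕ} {E F : Type*} [NormedAddCommGroup E] [NormedSpace ℝ E]
    [NormedAddCommGroup F] [NormedSpace ℝ F] (V : Fin ℓ → E → E) (a : TruncTensor ℓ N)
    (g : E → F) (x : E) : F :=
  ∑ k ∈ Finset.Icc 1 N, ∑ I : Fin k → Fin ℓ,
    a.coeff (List.ofFn I) • diffOp V (List.ofFn I) g x

/-- Solutions on `[0,T]` in the sense of Davie. -/
def IsDavieSolution {d ℓ : ℕ} (p T : ℝ)
    (V : Fin ℓ → EuclideanSpace ℝ (Fin d) → EuclideanSpace ℝ (Fin d))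
    (X : ℝ → (TruncTensor ℓ ⌊p⌋₊)ˣ) (z : ℝ → EuclideanSpace ℝ (Fin d)) : Prop :=
  ∃ a : ℝ, 1 < a ∧ ∃ C : ℝ, ∀ s t : ℝ, 0 ≤ s → s ≤ t → t ≤ T →
    ‖z t - (z s + taylorSum V (incr X s t) (fun x => x) (z s))‖ ≤ C * |t - s| ^ a

/-- Solutions on `[0,T]` in the sense of Bailleul, tested on all real functions of class `C^γ`.
The exponent `a` is common to all test functions, the constant depends on the test function. -/
def IsBailleulSolution {d ℓ : ℕ} (p γ T : ℝ)
    (V : Fin ℓ → EuclideanSpace ℝ (Fin d) → EuclideanSpace ℝ (Fin d))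
    (X : ℝ → (TruncTensor ℓ ⌊p⌋₊)ˣ) (z : ℝ → EuclideanSpace ℝ (Fin d)) : Prop :=
  ∃ a : ℝ, 1 < a ∧ ∀ f : EuclideanSpace ℝ (Fin d) → ℝ, IsClassC γ f →
    ∃ C : ℝ, ∀ s t : ℝ, 0 ≤ s → s ≤ t → t ≤ T →
      |f (z t) - (f (z s) + taylorSum V (incr X s t) f (z s))| ≤ C * |t - s| ^ a

end RoughPaths

end

noncomputable section

namespace RoughPaths

/-! Write `E_a f (x) = ∑_{|w| ≤ N} a^w (V_w f)(x)` for the full expansion (`expansion`), with `a =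
X_{ts}`, `x = z_s` and `h = |t - s|^{1/p}`, so that `|a^w| ≤ B h^{|w|}`. Both notions of solution
say that `f(z_t)` is `E_a f(z_s)` up to `|t - s|` to a power above 1: for all `f` of class `C^γ`, or
for the identity only. From Bailleul to Davie it suffices to test on the coordinate functions, which
are smooth.

From Davie to Bailleul, the point is that `E_a` is almost multiplicative. The Leibniz rule writes
`V_w(fg)` as a sum over the splittings of `w` into two complementary subwords, and the shuffle
relations for `a` turn `E_a(fg)` into the sum over pairs of words of total length at most `N`. The
product `E_a f · E_a g` is the sum over all pairs, so the two differ by `O(h^{N+1})`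
(`abs_expansion_mul_sub_le`, iterated in `exists_expansion_prod_bound`). Since `V_w f(x)` depends
only on the `N`-jet of `f` at `x`, `f` may be replaced in `E_a f(x)` by its Taylor polynomial, a
combination of products of centred coordinates. Hence `E_a f(x)` is close to that polynomial
evaluated at `E_a Id(x)`, thus at `z_t`, thus to `f(z_t)` (`exists_expansion_bound`). The errors are
`h^{N+1}`, the Davie error, and the Taylor remainder `|z_t - z_s|^{N+β}` with `β = min(γ - N, 1)`.
As `z` is bounded, `|z_t - z_s| = O(h)`, and `N + β > p` makes all exponents exceed 1.

The shuffle relations are proved by letting tensors act on functions of pairs of words, which is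
dual to the coproduct: Lie elements act as the sum of two commuting actions, so their exponentials
act as the product. This property passes to products and inverses, hence to increments
(`IsGroupLike`). -/

/-- The words of length at most `N`. -/
def words (ℓ N : ℕ) : Finset (List (Fin ℓ)) := (List.finite_length_le (Fin ℓ) N).toFinset

@[simp] theorem mem_words {ℓ N : ℕ} {w : List (Fin ℓ)} : w ∈ words ℓ N ↔ w.length ≤ N := by
  simp [words]

/-- Turns the coefficients of a product, which are sums over the cuts of one word, into sums over
pairs of words. -/
theorem sum_words_split {ℓ N : ℕ} {M : Type*} [AddCommMonoid M]
    (F : List (Fin ℓ) → List (Fin ℓ) → M) :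
    ∑ w ∈ words ℓ N, ∑ i ∈ Finset.range (w.length + 1), F (w.take i) (w.drop i) =
      ∑ q ∈ (words ℓ N ×ˢ words ℓ N) with q.1.length + q.2.length ≤ N, F q.1 q.2 := by
  rw [Finset.sum_sigma']
  refine Finset.sum_nbij' (fun x => (x.1.take x.2, x.1.drop x.2))
    (fun q => ⟨q.1 ++ q.2, q.1.length⟩) ?_ ?_ ?_ ?_ ?_
  · rintro ⟨w, i⟩ h
    simp only [Finset.mem_sigma, mem_words, Finset.mem_range] at h
    simp only [Finset.mem_filter, Finset.mem_product, mem_words, List.length_take,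
      List.length_drop]
    omega
  · rintro ⟨u, v⟩ h
    simp only [Finset.mem_filter, Finset.mem_product, mem_words] at h
    simp only [Finset.mem_sigma, mem_words, Finset.mem_range, List.length_append]
    omega
  · rintro ⟨w, i⟩ h
    simp only [Finset.mem_sigma, mem_words, Finset.mem_range] at h
    have : min i w.length = i := by omega
    simp [this]
  · rintro ⟨u, v⟩ _
    simp
  · rintro ⟨w, i⟩ _
    rfl

theorem sum_words {ℓ N : ℕ} {M : Type*} [AddCommMonoid M] (F : List (Fin ℓ) → M) :
    ∑ w ∈ words ℓ N, F w =
      F [] + ∑ k ∈ Finset.Icc 1 N, ∑ I : Fin k → Fin ℓ, F (List.ofFn I) := by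
  have h : ∑ w ∈ words ℓ N, F w =
      ∑ k ∈ Finset.range (N + 1), ∑ I : Fin k → Fin ℓ, F (List.ofFn I) := by
    rw [Finset.sum_sigma']
    refine Finset.sum_nbij' (fun w => List.equivSigmaTuple w)
      (fun x => List.equivSigmaTuple.symm x) ?_ ?_ ?_ ?_ ?_
    · intro w h
      rw [mem_words] at h
      simp only [List.equivSigmaTuple, Equiv.coe_fn_mk, Finset.mem_sigma, Finset.mem_range,
        Finset.mem_univ, and_true]
      omega
    · rintro ⟨k, I⟩ h
      simp only [Finset.mem_sigma, Finset.mem_range, Finset.mem_univ, and_true] at h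
      simp only [List.equivSigmaTuple, Equiv.coe_fn_symm_mk, mem_words, List.length_ofFn]
      omega
    · intro w _
      exact Equiv.symm_apply_apply _ _
    · intro x _
      exact Equiv.apply_symm_apply _ _
    · intro w _
      simp [List.equivSigmaTuple]
  rw [h, Finset.sum_range_succ']
  simp only [Finset.univ_unique, List.ofFn_zero, Finset.sum_const, Finset.card_singleton, one_smul]
  rw [add_comm]
  congr 1
  rw [Finset.range_eq_Ico, Finset.sum_Ico_add' (fun k => ∑ I : Fin k → Fin ℓ, F (List.ofFn I))]
  rfl

/-! ### Universal property of the truncated tensor algebra, and the exponential -/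

namespace TruncTensor

variable {ℓ N : ℕ} {A : Type*} [Ring A] [Algebra ℝ A]

theorem coeff_sum {ι : Type*} (s : Finset ι) (f : ι → TruncTensor ℓ N) (w : List (Fin ℓ)) :
    (∑ i ∈ s, f i).coeff w = ∑ i ∈ s, (f i).coeff w := by
  classical
  induction s using Finset.induction_on with
  | empty => simp
  | insert i s hi ih => simp [Finset.sum_insert hi, ih]

theorem coeff_mul_nil (a b : TruncTensor ℓ N) :
    (a * b).coeff [] = a.coeff [] * b.coeff [] := by
  simp [coeff_mul a b (w := []) (Nat.zero_le N)]

/-- The algebra homomorphism sending the letters to given elements, the products of more than `N`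
of which vanish. -/
def lift (r : Fin ℓ → A) (hr : ∀ w : List (Fin ℓ), N < w.length → (w.map r).prod = 0) :
    TruncTensor ℓ N →ₐ[ℝ] A :=
  AlgHom.ofLinearMap
    { toFun := fun a => ∑ w ∈ words ℓ N, a.coeff w • (w.map r).prod
      map_add' := by
        intro a b
        simp [add_smul, Finset.sum_add_distrib]
      map_smul' := by
        intro c a
        simp [mul_smul, Finset.smul_sum] }
    (by
      change ∑ w ∈ words ℓ N, (1 : TruncTensor ℓ N).coeff w • (w.map r).prod = 1
      rw [Finset.sum_eq_single []]
      · simp [coeff_one]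
      · intro w _ hw
        simp [coeff_one, hw]
      · simp)
    (by
      intro a b
      change ∑ w ∈ words ℓ N, (a * b).coeff w • (w.map r).prod =
        (∑ w ∈ words ℓ N, a.coeff w • (w.map r).prod) *
          ∑ w ∈ words ℓ N, b.coeff w • (w.map r).prod
      have h1 : ∀ w ∈ words ℓ N, (a * b).coeff w • (w.map r).prod =
          ∑ i ∈ Finset.range (w.length + 1), (a.coeff (w.take i) * b.coeff (w.drop i)) •
            (((w.take i).map r).prod * ((w.drop i).map r).prod) := by
        intro w hw
        rw [coeff_mul _ _ (mem_words.mp hw), Finset.sum_smul]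
        refine Finset.sum_congr rfl fun i _ => ?_
        rw [← List.prod_append, ← List.map_append, List.take_append_drop]
      rw [Finset.sum_congr rfl h1, sum_words_split
        (fun u v => (a.coeff u * b.coeff v) • ((u.map r).prod * (v.map r).prod)),
        Finset.sum_mul_sum, ← Finset.sum_product', Finset.sum_filter]
      refine Finset.sum_congr rfl fun q _ => ?_
      split_ifs with h
      · rw [smul_mul_smul_comm]
      -- Pairs of total length above `N` are absent from the truncated product; `hr` makes them
      -- vanish in `A` as well.
      · rw [smul_mul_smul_comm, ← List.prod_append, ← List.map_append, hr _ (by simp; omega),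
          smul_zero])

theorem lift_apply (r : Fin ℓ → A)
    (hr : ∀ w : List (Fin ℓ), N < w.length → (w.map r).prod = 0) (a : TruncTensor ℓ N) :
    lift r hr a = ∑ w ∈ words ℓ N, a.coeff w • (w.map r).prod := rfl

theorem lift_letter (r : Fin ℓ → A)
    (hr : ∀ w : List (Fin ℓ), N < w.length → (w.map r).prod = 0) (i : Fin ℓ) :
    lift r hr (letter i) = r i := by
  have hc : ∀ w, (letter i : TruncTensor ℓ N).coeff w = if w = [i] ∧ 1 ≤ N then 1 else 0 :=
    fun _ => rfl
  rw [lift_apply]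
  rcases Nat.lt_or_ge N 1 with hN | hN
  · have h0 := hr [i] (by simpa using hN)
    simp only [List.map_cons, List.map_nil, List.prod_cons, List.prod_nil, mul_one] at h0
    rw [h0]
    refine Finset.sum_eq_zero fun w _ => ?_
    rw [hc, if_neg (by omega), zero_smul]
  · rw [Finset.sum_eq_single [i]]
    · simp [hc, hN]
    · intro w _ hw
      simp [hc, hw]
    · intro h
      simp only [mem_words, List.length_cons, List.length_nil] at h
      omega

theorem coeff_pow_eq_zero {a : TruncTensor ℓ N} (ha : a.coeff [] = 0) (k : ℕ)
    {w : List (Fin ℓ)} (hw : w.length < k) : (a ^ k).coeff w = 0 := by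
  induction k generalizing w with
  | zero => omega
  | succ k ih =>
    by_cases hN : w.length ≤ N
    · rw [pow_succ, coeff_mul _ _ hN]
      refine Finset.sum_eq_zero fun i hi => ?_
      rw [Finset.mem_range] at hi
      -- Either the prefix is shorter than `k`, or the suffix is empty and meets the zero constant
      -- term.
      rcases Nat.lt_or_ge i k with h | h
      · rw [ih (by rw [List.length_take]; omega), zero_mul]
      · rw [List.drop_eq_nil_of_le (by omega), ha, mul_zero]
    · exact coeff_eq_zero _ (not_le.mp hN)

theorem pow_succ_eq_zero {a : TruncTensor ℓ N} (ha : a.coeff [] = 0) : a ^ (N + 1) = 0 :=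
  ext_of_le fun _ hw => coeff_pow_eq_zero ha _ (Nat.lt_succ_of_le hw)

/-- As `a ^ (N + 1) = 0`, the truncated sum is the true exponential. This gives access to the
addition formula for commuting nilpotent elements. -/
theorem map_exp {A : Type*} [Ring A] [Algebra ℝ A] [Module ℚ A] (φ : TruncTensor ℓ N →ₐ[ℝ] A)
    {a : TruncTensor ℓ N} (ha : a.coeff [] = 0) :
    IsNilpotent (φ a) ∧ φ a.exp = IsNilpotent.exp (φ a) := by
  have h : φ a ^ (N + 1) = 0 := by rw [← map_pow, pow_succ_eq_zero ha, map_zero]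
  refine ⟨⟨_, h⟩, ?_⟩
  rw [IsNilpotent.exp_eq_sum h, exp, map_sum]
  refine Finset.sum_congr rfl fun k _ => ?_
  rw [map_smul, map_pow, ← Rat.cast_smul_eq_qsmul ℝ]
  simp

theorem coeff_exp_nil {a : TruncTensor ℓ N} (ha : a.coeff [] = 0) : a.exp.coeff [] = 1 := by
  rw [exp, coeff_sum, Finset.sum_eq_single 0]
  · simp [coeff_one]
  · intro k _ hk
    rw [coeff_smul, coeff_pow_eq_zero ha k (by simpa using Nat.pos_of_ne_zero hk), mul_zero]
  · simp

end TruncTensor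

theorem coeff_nil_of_mem_freeNilpotentLieAlgebra {ℓ N : ℕ} {a : TruncTensor ℓ N}
    (ha : a ∈ freeNilpotentLieAlgebra ℓ N) : a.coeff [] = 0 := by
  induction ha using LieSubalgebra.lieSpan_induction with
  | mem x h =>
    obtain ⟨i, rfl⟩ := h
    simp [TruncTensor.letter, TruncTensor.coeff]
  | zero => rfl
  | add x y _ _ hx hy => simp [hx, hy]
  | smul c x _ hx => simp [hx]
  | lie x y _ _ hx hy =>
    rw [Ring.lie_def, sub_eq_add_neg, ← neg_one_smul ℝ (y * x), TruncTensor.coeff_add,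
      TruncTensor.coeff_smul, TruncTensor.coeff_mul_nil, TruncTensor.coeff_mul_nil, hx, hy]
    simp

/-! ### Shuffle relations for group-like tensors -/

/-- Sum over the ways to split a word into a subword and the complementary subword. -/
def unshuffleSum {α M : Type*} [AddCommMonoid M] : List α → (List α → List α → M) → M
  | [], φ => φ [] []
  | i :: w, φ => unshuffleSum w (fun u v => φ (i :: u) v) + unshuffleSum w (fun u v => φ u (i :: v))

/-- Endomorphisms of the space of real functions on pairs of words. -/
abbrev PairEnd (ℓ : ℕ) : Type := Module.End ℝ (List (Fin ℓ) → List (Fin ℓ) → ℝ)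

section GroupLike

variable {ℓ : ℕ}

/-- Appending a letter to the left word, truncated at total length `N`. -/
def shiftLeft (N : ℕ) (i : Fin ℓ) : PairEnd ℓ where
  toFun φ := fun u v => if u.length + v.length < N then φ (u ++ [i]) v else 0
  map_add' φ ψ := by
    ext u v
    by_cases h : u.length + v.length < N <;> simp [h]
  map_smul' c φ := by
    ext u v
    by_cases h : u.length + v.length < N <;> simp [h]

/-- Appending a letter to the right word, truncated at total length `N`. -/
def shiftRight (N : ℕ) (i : Fin ℓ) : PairEnd ℓ where
  toFun φ := fun u v => if u.length + v.length < N then φ u (v ++ [i]) else 0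
  map_add' φ ψ := by
    ext u v
    by_cases h : u.length + v.length < N <;> simp [h]
  map_smul' c φ := by
    ext u v
    by_cases h : u.length + v.length < N <;> simp [h]

theorem shiftLeft_apply (N : ℕ) (i : Fin ℓ) (φ : List (Fin ℓ) → List (Fin ℓ) → ℝ)
    (u v : List (Fin ℓ)) : shiftLeft N i φ u v =
      if u.length + v.length < N then φ (u ++ [i]) v else 0 := rfl

theorem shiftRight_apply (N : ℕ) (i : Fin ℓ) (φ : List (Fin ℓ) → List (Fin ℓ) → ℝ)
    (u v : List (Fin ℓ)) : shiftRight N i φ u v =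
      if u.length + v.length < N then φ u (v ++ [i]) else 0 := rfl

/-- Letters are appended on the right so that composing the operators spells `w` in its own order.
The case `w = []` is separate because the empty product is the identity, even beyond the truncation.
-/
theorem prod_shiftLeft_apply (N : ℕ) (w : List (Fin ℓ)) (φ : List (Fin ℓ) → List (Fin ℓ) → ℝ)
    (u v : List (Fin ℓ)) : (w.map (shiftLeft N)).prod φ u v =
      if w = [] ∨ u.length + v.length + w.length ≤ N then φ (u ++ w) v else 0 := by
  induction w generalizing u with
  | nil => simp
  | cons i w ih =>
    rw [List.map_cons, List.prod_cons, Module.End.mul_apply, shiftLeft_apply, ih]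
    simp only [List.length_append, List.length_cons, List.length_nil, reduceCtorEq, false_or,
      List.append_assoc, List.singleton_append]
    rcases eq_or_ne w [] with rfl | hw
    · simp
    · simp only [hw, false_or, ← ite_and]
      congr 1
      simp only [eq_iff_iff]
      omega

theorem prod_shiftRight_apply (N : ℕ) (w : List (Fin ℓ)) (φ : List (Fin ℓ) → List (Fin ℓ) → ℝ)
    (u v : List (Fin ℓ)) : (w.map (shiftRight N)).prod φ u v =
      if w = [] ∨ u.length + v.length + w.length ≤ N then φ u (v ++ w) else 0 := by
  induction w generalizing v with
  | nil => simp
  | cons i w ih =>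
    rw [List.map_cons, List.prod_cons, Module.End.mul_apply, shiftRight_apply, ih]
    simp only [List.length_append, List.length_cons, List.length_nil, reduceCtorEq, false_or,
      List.append_assoc, List.singleton_append]
    rcases eq_or_ne w [] with rfl | hw
    · simp
    · simp only [hw, false_or, ← ite_and]
      congr 1
      simp only [eq_iff_iff]
      omega

theorem prod_shift_add_apply (N : ℕ) (w : List (Fin ℓ)) (φ : List (Fin ℓ) → List (Fin ℓ) → ℝ)
    (u v : List (Fin ℓ)) :
    (w.map (fun i => shiftLeft N i + shiftRight N i)).prod φ u v =
      if w = [] ∨ u.length + v.length + w.length ≤ N then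
        unshuffleSum w (fun u' v' => φ (u ++ u') (v ++ v')) else 0 := by
  induction w generalizing u v with
  | nil => simp [unshuffleSum]
  | cons i w ih =>
    rw [List.map_cons, List.prod_cons, Module.End.mul_apply, LinearMap.add_apply, Pi.add_apply,
      Pi.add_apply, shiftLeft_apply, shiftRight_apply, ih, ih]
    simp only [List.length_append, List.length_cons, List.length_nil, reduceCtorEq, false_or,
      List.append_assoc, List.singleton_append, unshuffleSum]
    have e1 : u.length + (0 + 1) + v.length + w.length = u.length + v.length + (w.length + 1) := by
      omega
    have e2 : u.length + (v.length + (0 + 1)) + w.length =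
      u.length + v.length + (w.length + 1) := by omega
    rw [e1, e2]
    rcases eq_or_ne w [] with rfl | hw
    · by_cases h : u.length + v.length < N <;> simp [h]
    · by_cases h : u.length + v.length + (w.length + 1) ≤ N
      · have h' : u.length + v.length < N := by omega
        simp [h, h', hw]
      · simp [h, hw]

/-- Both truncations test the total length of the pair, so they agree in either order. -/
theorem commute_shift (N : ℕ) (i j : Fin ℓ) : Commute (shiftLeft N i) (shiftRight N j) := by
  refine LinearMap.ext fun φ => funext fun u => funext fun v => ?_
  simp only [Module.End.mul_apply, shiftLeft_apply, shiftRight_apply, List.length_append,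
    List.length_cons, List.length_nil]
  have e : u.length + (v.length + (0 + 1)) = u.length + (0 + 1) + v.length := by omega
  rw [e]

section

variable (ℓ) (N : ℕ)

/-- The action of tensors on the left word. -/
def leftAction : TruncTensor ℓ N →ₐ[ℝ] PairEnd ℓ :=
  TruncTensor.lift (shiftLeft N) fun w hw => by
    refine LinearMap.ext fun φ => funext fun u => funext fun v => ?_
    have : w ≠ [] := by rintro rfl; simp at hw
    rw [prod_shiftLeft_apply, if_neg (by simp only [this, false_or]; omega)]
    rfl

/-- The action of tensors on the right word. -/
def rightAction : TruncTensor ℓ N →ₐ[ℝ] PairEnd ℓ :=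
  TruncTensor.lift (shiftRight N) fun w hw => by
    refine LinearMap.ext fun φ => funext fun u => funext fun v => ?_
    have : w ≠ [] := by rintro rfl; simp at hw
    rw [prod_shiftRight_apply, if_neg (by simp only [this, false_or]; omega)]
    rfl

/-- The action of tensors on pairs of words in which letters act as derivations. -/
def pairAction : TruncTensor ℓ N →ₐ[ℝ] PairEnd ℓ :=
  TruncTensor.lift (fun i => shiftLeft N i + shiftRight N i) fun w hw => by
    refine LinearMap.ext fun φ => funext fun u => funext fun v => ?_
    have : w ≠ [] := by rintro rfl; simp at hw
    rw [prod_shift_add_apply, if_neg (by simp only [this, false_or]; omega)]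
    rfl

end

variable {N : ℕ}

theorem commute_leftAction_rightAction (a b : TruncTensor ℓ N) :
    Commute (leftAction ℓ N a) (rightAction ℓ N b) := by
  rw [leftAction, rightAction, TruncTensor.lift_apply, TruncTensor.lift_apply]
  refine Commute.sum_left _ _ _ fun u _ => Commute.sum_right _ _ _ fun v _ => ?_
  refine Commute.smul_left (Commute.smul_right ?_ _) _
  refine Commute.list_prod_left _ _ fun x hx => Commute.list_prod_right _ _ fun y hy => ?_
  obtain ⟨i, _, rfl⟩ := List.mem_map.mp hx
  obtain ⟨j, _, rfl⟩ := List.mem_map.mp hy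
  exact commute_shift N i j

/-- Lie elements are primitive: the identity holds on letters by construction, and it survives
brackets because the mixed terms cancel by commutation. -/
theorem pairAction_of_mem_freeNilpotentLieAlgebra {a : TruncTensor ℓ N}
    (ha : a ∈ freeNilpotentLieAlgebra ℓ N) :
    pairAction ℓ N a = leftAction ℓ N a + rightAction ℓ N a := by
  induction ha using LieSubalgebra.lieSpan_induction with
  | mem x h =>
    obtain ⟨i, rfl⟩ := h
    simp only [pairAction, leftAction, rightAction, TruncTensor.lift_letter]
  | zero => simp
  | add x y _ _ hx hy => simp only [map_add, hx, hy]; abel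
  | smul c x _ hx => simp only [map_smul, hx, smul_add]
  | lie x y _ _ hx hy =>
    have h1 := (commute_leftAction_rightAction x y).eq
    have h2 := (commute_leftAction_rightAction y x).eq
    simp only [Ring.lie_def, map_sub, map_mul, hx, hy, add_mul, mul_add]
    rw [h1, h2]
    abel

/-- Group-like tensors: those with constant term `1` whose coordinates satisfy the shuffle
relations, expressed through the actions on pairs of words. -/
structure IsGroupLike (a : TruncTensor ℓ N) : Prop where
  coeff_nil : a.coeff [] = 1
  pairAction_eq : pairAction ℓ N a = leftAction ℓ N a * rightAction ℓ N a

/-- For commuting nilpotent operators, `exp (L + R) = exp L * exp R`. -/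
theorem IsGroupLike.of_mem {a : TruncTensor ℓ N} (ha : a ∈ freeNilpotentGroup ℓ N) :
    IsGroupLike a := by
  obtain ⟨b, hb, rfl⟩ := ha
  have hb0 := coeff_nil_of_mem_freeNilpotentLieAlgebra hb
  refine ⟨TruncTensor.coeff_exp_nil hb0, ?_⟩
  obtain ⟨n1, e1⟩ := TruncTensor.map_exp (leftAction ℓ N) hb0
  obtain ⟨n2, e2⟩ := TruncTensor.map_exp (rightAction ℓ N) hb0
  obtain ⟨_, e3⟩ := TruncTensor.map_exp (pairAction ℓ N) hb0
  rw [e1, e2, e3, pairAction_of_mem_freeNilpotentLieAlgebra hb,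
    IsNilpotent.exp_add_of_commute (commute_leftAction_rightAction b b) n1 n2]

theorem IsGroupLike.mul {a b : TruncTensor ℓ N} (ha : IsGroupLike a) (hb : IsGroupLike b) :
    IsGroupLike (a * b) := by
  refine ⟨by rw [TruncTensor.coeff_mul_nil, ha.coeff_nil, hb.coeff_nil, one_mul], ?_⟩
  rw [map_mul, map_mul, map_mul, ha.pairAction_eq, hb.pairAction_eq,
    (commute_leftAction_rightAction b a).symm.mul_mul_mul_comm]

/-- Since the two actions commute, the inverse of `L u * R u` is `L u⁻¹ * R u⁻¹`. -/
theorem IsGroupLike.inv {u : (TruncTensor ℓ N)ˣ} (hu : IsGroupLike (u : TruncTensor ℓ N)) :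
    IsGroupLike ((u⁻¹ : (TruncTensor ℓ N)ˣ) : TruncTensor ℓ N) := by
  constructor
  · have h := congrArg (fun b => TruncTensor.coeff b []) u.mul_inv
    simp only [TruncTensor.coeff_mul_nil, hu.coeff_nil, one_mul] at h
    simpa [TruncTensor.coeff_one] using h
  · set v : TruncTensor ℓ N := ((u⁻¹ : (TruncTensor ℓ N)ˣ) : TruncTensor ℓ N) with hv
    have h1 : (v : TruncTensor ℓ N) * u = 1 := u.inv_mul
    have h2 : (u : TruncTensor ℓ N) * v = 1 := u.mul_inv
    have h3 : pairAction ℓ N u * (leftAction ℓ N v * rightAction ℓ N v) = 1 := by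
      rw [hu.pairAction_eq, (commute_leftAction_rightAction v u).symm.mul_mul_mul_comm,
        ← map_mul, ← map_mul, h2, map_one, map_one, one_mul]
    calc pairAction ℓ N v
        = pairAction ℓ N v * (pairAction ℓ N u * (leftAction ℓ N v * rightAction ℓ N v)) := by
          rw [h3, mul_one]
      _ = leftAction ℓ N v * rightAction ℓ N v := by
          rw [← mul_assoc, ← map_mul, h1, map_one, one_mul]

/-- The shuffle relations in dual form. -/
theorem IsGroupLike.sum_unshuffleSum {a : TruncTensor ℓ N} (ha : IsGroupLike a)
    (φ : List (Fin ℓ) → List (Fin ℓ) → ℝ) :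
    ∑ w ∈ words ℓ N, a.coeff w * unshuffleSum w φ =
      ∑ q ∈ (words ℓ N ×ˢ words ℓ N) with q.1.length + q.2.length ≤ N,
        a.coeff q.1 * a.coeff q.2 * φ q.1 q.2 := by
  -- At the pair of empty words the operators read off the values of `φ` at the words themselves.
  have h := congrFun (congrFun (LinearMap.congr_fun ha.pairAction_eq φ) []) []
  rw [Module.End.mul_apply] at h
  simp only [pairAction, leftAction, rightAction, TruncTensor.lift_apply, LinearMap.sum_apply,
    LinearMap.smul_apply, Finset.sum_apply, Pi.smul_apply, prod_shift_add_apply,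
    prod_shiftLeft_apply, prod_shiftRight_apply, smul_eq_mul, List.nil_append, List.length_nil,
    zero_add, add_zero] at h
  have h1 : ∀ w ∈ words ℓ N, a.coeff w * unshuffleSum w φ =
      a.coeff w * (if w = [] ∨ w.length ≤ N then unshuffleSum w (fun u v => φ u v) else 0) := by
    intro w hw
    rw [if_pos (Or.inr (mem_words.mp hw))]
  rw [Finset.sum_congr rfl h1, h, Finset.sum_filter, Finset.sum_product]
  refine Finset.sum_congr rfl fun u hu => ?_
  rw [if_pos (Or.inr (mem_words.mp hu)), Finset.mul_sum]
  refine Finset.sum_congr rfl fun v _ => ?_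
  rw [mem_words] at hu
  rcases eq_or_ne v [] with rfl | hv
  · simp [hu, mul_assoc]
  · by_cases h' : u.length + v.length ≤ N <;> simp [h', hv, mul_assoc]

end GroupLike

/-! ### Iterated directional derivatives -/

section DiffOp

variable {ℓ : ℕ} {E F G : Type*} [NormedAddCommGroup E] [NormedSpace ℝ E] [NormedAddCommGroup F]
  [NormedSpace ℝ F] [NormedAddCommGroup G] [NormedSpace ℝ G] {V : Fin ℓ → E → E}

/-- Each letter costs one derivative, so fields and function of class `C^n` suffice for words of
length up to `n`. -/
theorem contDiff_diffOp {n : ℕ} (hV : ∀ i, ContDiff ℝ n (V i)) {g : E → F} (hg : ContDiff ℝ n g)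
    {w : List (Fin ℓ)} {m : ℕ} (hm : w.length + m ≤ n) : ContDiff ℝ m (diffOp V w g) := by
  induction w generalizing m with
  | nil => exact hg.of_le (by exact_mod_cast (by simpa using hm))
  | cons i w ih =>
    rw [List.length_cons] at hm
    have h := ih (m := m + 1) (by omega)
    exact (h.fderiv_right (m := m) (by norm_cast)).clm_apply
      ((hV i).of_le (by exact_mod_cast (by omega)))

theorem differentiableAt_diffOp {n : ℕ} (hV : ∀ i, ContDiff ℝ n (V i)) {g : E → F}
    (hg : ContDiff ℝ n g) {w : List (Fin ℓ)} (hw : w.length < n) (x : E) :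
    DifferentiableAt ℝ (diffOp V w g) x :=
  (contDiff_diffOp hV hg (m := 1) hw).differentiable (by norm_num) x

theorem continuous_diffOp {n : ℕ} (hV : ∀ i, ContDiff ℝ n (V i)) {g : E → F}
    (hg : ContDiff ℝ n g) {w : List (Fin ℓ)} (hw : w.length ≤ n) : Continuous (diffOp V w g) :=
  (contDiff_diffOp hV hg (m := 0) hw).continuous

theorem diffOp_clm_comp {n : ℕ} (hV : ∀ i, ContDiff ℝ n (V i)) {g : E → F}
    (hg : ContDiff ℝ n g) (L : F →L[ℝ] G) {w : List (Fin ℓ)} (hw : w.length ≤ n) :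
    diffOp V w (fun x => L (g x)) = fun x => L (diffOp V w g x) := by
  induction w with
  | nil => rfl
  | cons i w ih =>
    rw [List.length_cons] at hw
    funext x
    have h := (L.hasFDerivAt.comp x (differentiableAt_diffOp hV hg hw x).hasFDerivAt).fderiv
    simp only [Function.comp_def] at h
    simp only [diffOp, ih (by omega)]
    rw [h]
    rfl

theorem diffOp_sub {n : ℕ} (hV : ∀ i, ContDiff ℝ n (V i)) {f g : E → F}
    (hf : ContDiff ℝ n f) (hg : ContDiff ℝ n g) {w : List (Fin ℓ)} (hw : w.length ≤ n) :
    diffOp V w (fun x => f x - g x) = fun x => diffOp V w f x - diffOp V w g x := by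
  induction w with
  | nil => rfl
  | cons i w ih =>
    rw [List.length_cons] at hw
    funext x
    simp only [diffOp, ih (by omega)]
    rw [fderiv_fun_sub (differentiableAt_diffOp hV hf hw x) (differentiableAt_diffOp hV hg hw x)]
    rfl

theorem diffOp_sum {n : ℕ} (hV : ∀ i, ContDiff ℝ n (V i)) {ι : Type*} (s : Finset ι)
    {f : ι → E → F} (hf : ∀ j ∈ s, ContDiff ℝ n (f j)) {w : List (Fin ℓ)} (hw : w.length ≤ n) :
    diffOp V w (fun x => ∑ j ∈ s, f j x) = fun x => ∑ j ∈ s, diffOp V w (f j) x := by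
  induction w with
  | nil => rfl
  | cons i w ih =>
    rw [List.length_cons] at hw
    funext x
    simp only [diffOp, ih (by omega)]
    rw [fderiv_fun_sum fun j hj => differentiableAt_diffOp hV (hf j hj) hw x]
    simp

theorem diffOp_const (c : F) (w : List (Fin ℓ)) :
    diffOp V w (fun _ => c) = fun _ => if w = [] then c else 0 := by
  induction w with
  | nil => simp [diffOp]
  | cons i w ih =>
    funext x
    simp only [diffOp, ih]
    simp

/-- The differential operators of order at most `n` only depend on the `n`-jet. -/
theorem diffOp_eq_zero_of_iteratedFDeriv_eq_zero {n : ℕ} (hV : ∀ i, ContDiff ℝ n (V i))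
    {g : E → F} (hg : ContDiff ℝ n g) {x : E} (hx : ∀ j ≤ n, iteratedFDeriv ℝ j g x = 0)
    {w : List (Fin ℓ)} (hw : w.length ≤ n) : diffOp V w g x = 0 := by
  -- Strengthened to the derivatives of `V_w g` at `x`: order `j` for a longer word calls for orders
  -- up to `j + 1` for the shorter one.
  have key : ∀ w : List (Fin ℓ), ∀ j, w.length + j ≤ n →
      iteratedFDeriv ℝ j (diffOp V w g) x = 0 := by
    intro w
    induction w with
    | nil =>
      intro j hj
      exact hx j (by simpa using hj)
    | cons i w ih =>
      intro j hj
      rw [List.length_cons] at hj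
      have h1 : ContDiff ℝ j (fderiv ℝ (diffOp V w g)) :=
        (contDiff_diffOp hV hg (m := j + 1) (by omega)).fderiv_right (by norm_cast)
      have h2 : ContDiff ℝ j (V i) := (hV i).of_le (by exact_mod_cast (by omega))
      have h3 := norm_iteratedFDeriv_clm_apply h1 h2 x le_rfl
      rw [Finset.sum_eq_zero] at h3
      · exact norm_le_zero_iff.mp h3
      · intro k hk
        rw [Finset.mem_range] at hk
        rw [norm_iteratedFDeriv_fderiv, ih (k + 1) (by omega)]
        simp
  have h := key w 0 (by simpa using hw)
  rwa [← norm_eq_zero, norm_iteratedFDeriv_zero, norm_eq_zero] at h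

theorem hasFDerivAt_unshuffleSum {w : List (Fin ℓ)} {φ : E → List (Fin ℓ) → List (Fin ℓ) → F}
    {φ' : List (Fin ℓ) → List (Fin ℓ) → E →L[ℝ] F} {x : E}
    (h : ∀ u v : List (Fin ℓ), u.length ≤ w.length → v.length ≤ w.length →
      HasFDerivAt (fun y => φ y u v) (φ' u v) x) :
    HasFDerivAt (fun y => unshuffleSum w (φ y)) (unshuffleSum w φ') x := by
  induction w generalizing φ φ' with
  | nil => exact h [] [] le_rfl le_rfl
  | cons i w ih =>
    simp only [unshuffleSum]
    refine (ih fun u v hu hv => ?_).fun_add (ih fun u v hu hv => ?_)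
    · exact h (i :: u) v (by simpa using hu) (by rw [List.length_cons]; omega)
    · exact h u (i :: v) (by rw [List.length_cons]; omega) (by simpa using hv)

theorem map_unshuffleSum {α M M' : Type*} [AddCommMonoid M] [AddCommMonoid M'] (L : M →+ M')
    (w : List α) (φ : List α → List α → M) :
    L (unshuffleSum w φ) = unshuffleSum w (fun u v => L (φ u v)) := by
  induction w generalizing φ with
  | nil => rfl
  | cons i w ih => simp only [unshuffleSum, map_add, ih]

theorem unshuffleSum_add {α M : Type*} [AddCommMonoid M] (w : List α)
    (φ ψ : List α → List α → M) :
    unshuffleSum w (fun u v => φ u v + ψ u v) = unshuffleSum w φ + unshuffleSum w ψ := by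
  induction w generalizing φ ψ with
  | nil => rfl
  | cons i w ih => simp only [unshuffleSum, ih]; abel

theorem abs_unshuffleSum_le {α : Type*} (w : List α) {φ : List α → List α → ℝ} {M : ℝ}
    (h : ∀ u v : List α, u.length ≤ w.length → v.length ≤ w.length → |φ u v| ≤ M) :
    |unshuffleSum w φ| ≤ 2 ^ w.length * M := by
  induction w generalizing φ with
  | nil => simpa [unshuffleSum] using h [] [] le_rfl le_rfl
  | cons i w ih =>
    have h1 := ih (φ := fun u v => φ (i :: u) v) fun u v hu hv =>
      h (i :: u) v (by simpa using hu) (by rw [List.length_cons]; omega)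
    have h2 := ih (φ := fun u v => φ u (i :: v)) fun u v hu hv =>
      h u (i :: v) (by rw [List.length_cons]; omega) (by simpa using hv)
    calc |unshuffleSum (i :: w) φ| ≤ 2 ^ w.length * M + 2 ^ w.length * M :=
          (abs_add_le _ _).trans (add_le_add h1 h2)
      _ = 2 ^ (i :: w).length * M := by rw [List.length_cons, pow_succ]; ring

/-- The Leibniz rule for iterated directional derivatives. -/
theorem diffOp_mul {n : ℕ} (hV : ∀ i, ContDiff ℝ n (V i)) {f g : E → ℝ}
    (hf : ContDiff ℝ n f) (hg : ContDiff ℝ n g) {w : List (Fin ℓ)} (hw : w.length ≤ n) :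
    diffOp V w (fun x => f x * g x) =
      fun x => unshuffleSum w (fun u v => diffOp V u f x * diffOp V v g x) := by
  induction w with
  | nil => rfl
  | cons i w ih =>
    rw [List.length_cons] at hw
    funext x
    simp only [diffOp, ih (by omega)]
    have h := hasFDerivAt_unshuffleSum (w := w) (x := x)
      (φ := fun y u v => diffOp V u f y * diffOp V v g y) fun u v hu hv =>
      (differentiableAt_diffOp hV hf (w := u) (by omega) x).hasFDerivAt.mul
        (differentiableAt_diffOp hV hg (w := v) (by omega) x).hasFDerivAt
    rw [h.fderiv]
    have e := map_unshuffleSum (ContinuousLinearMap.apply ℝ ℝ (V i x)).toLinearMap.toAddMonoidHom w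
      (fun u v => diffOp V u f x • fderiv ℝ (diffOp V v g) x +
        diffOp V v g x • fderiv ℝ (diffOp V u f) x)
    simp only [LinearMap.toAddMonoidHom_coe, ContinuousLinearMap.coe_coe,
      ContinuousLinearMap.apply_apply, add_apply, smul_apply, smul_eq_mul] at e
    -- The new letter differentiates either `f` or `g`, that is, it joins the left or the right
    -- subword, as in the recursion for `unshuffleSum`.
    rw [e, unshuffleSum_add, add_comm]
    simp only [unshuffleSum, diffOp, mul_comm]

end DiffOp

/-! ### Truncated expansions and their approximate multiplicativity -/

section Expansion

variable {ℓ N : ℕ} {E F G : Type*} [NormedAddCommGroup E] [NormedSpace ℝ E]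
  [NormedAddCommGroup F] [NormedSpace ℝ F] [NormedAddCommGroup G] [NormedSpace ℝ G]
  {V : Fin ℓ → E → E}

/-- The sum `∑_{|w| ≤ N} a^w (V_w g)(x)`, including the empty word. -/
def expansion (V : Fin ℓ → E → E) (a : TruncTensor ℓ N) (g : E → F) (x : E) : F :=
  ∑ w ∈ words ℓ N, a.coeff w • diffOp V w g x

theorem expansion_eq {a : TruncTensor ℓ N} (ha : a.coeff [] = 1) (g : E → F) (x : E) :
    expansion V a g x = g x + taylorSum V a g x := by
  rw [expansion, sum_words, ha, one_smul]
  rfl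

theorem expansion_clm_comp (hV : ∀ i, ContDiff ℝ N (V i)) {g : E → F} (hg : ContDiff ℝ N g)
    (L : F →L[ℝ] G) (a : TruncTensor ℓ N) (x : E) :
    expansion V a (fun y => L (g y)) x = L (expansion V a g x) := by
  simp only [expansion, map_sum, map_smul]
  refine Finset.sum_congr rfl fun w hw => ?_
  rw [diffOp_clm_comp hV hg L (mem_words.mp hw)]

theorem expansion_sub (hV : ∀ i, ContDiff ℝ N (V i)) {f g : E → F} (hf : ContDiff ℝ N f)
    (hg : ContDiff ℝ N g) (a : TruncTensor ℓ N) (x : E) :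
    expansion V a (fun y => f y - g y) x = expansion V a f x - expansion V a g x := by
  simp only [expansion, ← Finset.sum_sub_distrib, ← smul_sub]
  refine Finset.sum_congr rfl fun w hw => ?_
  rw [diffOp_sub hV hf hg (mem_words.mp hw)]

theorem expansion_sum (hV : ∀ i, ContDiff ℝ N (V i)) {ι : Type*} (s : Finset ι) {f : ι → E → F}
    (hf : ∀ j ∈ s, ContDiff ℝ N (f j)) (a : TruncTensor ℓ N) (x : E) :
    expansion V a (fun y => ∑ j ∈ s, f j y) x = ∑ j ∈ s, expansion V a (f j) x := by
  simp only [expansion]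
  rw [Finset.sum_comm]
  refine Finset.sum_congr rfl fun w hw => ?_
  rw [diffOp_sum hV s hf (mem_words.mp hw), Finset.smul_sum]

theorem expansion_const {a : TruncTensor ℓ N} (ha : a.coeff [] = 1) (c : F) (x : E) :
    expansion V a (fun _ => c) x = c := by
  rw [expansion, Finset.sum_eq_single []]
  · simp [diffOp_const, ha]
  · intro w _ hw
    simp [diffOp_const, hw]
  · simp

/-- The Leibniz rule produces sums over splittings of words, which the shuffle relations rewrite as
sums over pairs. -/
theorem expansion_mul (hV : ∀ i, ContDiff ℝ N (V i)) {f g : E → ℝ} (hf : ContDiff ℝ N f)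
    (hg : ContDiff ℝ N g) {a : TruncTensor ℓ N} (ha : IsGroupLike a) (x : E) :
    expansion V a (fun y => f y * g y) x =
      ∑ q ∈ (words ℓ N ×ˢ words ℓ N) with q.1.length + q.2.length ≤ N,
        a.coeff q.1 * a.coeff q.2 * (diffOp V q.1 f x * diffOp V q.2 g x) := by
  rw [← ha.sum_unshuffleSum (fun u v => diffOp V u f x * diffOp V v g x), expansion]
  refine Finset.sum_congr rfl fun w hw => ?_
  rw [diffOp_mul hV hf hg (mem_words.mp hw), smul_eq_mul]

theorem abs_expansion_le {f : E → ℝ} {x : E} {a : TruncTensor ℓ N} {B H M h : ℝ}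
    (hB : 0 ≤ B) (hH : 1 ≤ H) (h0 : 0 ≤ h) (hh : h ≤ H)
    (ha : ∀ w, |a.coeff w| ≤ B * h ^ w.length)
    (hf : ∀ w : List (Fin ℓ), w.length ≤ N → |diffOp V w f x| ≤ M) :
    |expansion V a f x| ≤ (words ℓ N).card * (B * H ^ N * M) := by
  rw [expansion, ← nsmul_eq_mul]
  refine (Finset.abs_sum_le_sum_abs _ _).trans (Finset.sum_le_card_nsmul _ _ _ fun w hw => ?_)
  rw [mem_words] at hw
  rw [smul_eq_mul, abs_mul]
  have h1 : h ^ w.length ≤ H ^ N :=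
    (pow_le_pow_left₀ h0 hh _).trans (pow_le_pow_right₀ hH hw)
  exact mul_le_mul ((ha w).trans (mul_le_mul_of_nonneg_left h1 hB)) (hf w hw) (abs_nonneg _)
    (by positivity)

/-- The expansion is multiplicative up to terms of order larger than `N`. -/
theorem abs_expansion_mul_sub_le (hV : ∀ i, ContDiff ℝ N (V i)) {f g : E → ℝ}
    (hf : ContDiff ℝ N f) (hg : ContDiff ℝ N g) {x : E} {a : TruncTensor ℓ N}
    (hgl : IsGroupLike a) {B H M M' h : ℝ} (hM : 0 ≤ M) (hM' : 0 ≤ M') (hB : 0 ≤ B) (hH : 1 ≤ H)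
    (h0 : 0 ≤ h) (hh : h ≤ H) (ha : ∀ w, |a.coeff w| ≤ B * h ^ w.length)
    (hfM : ∀ w : List (Fin ℓ), w.length ≤ N → |diffOp V w f x| ≤ M)
    (hgM : ∀ w : List (Fin ℓ), w.length ≤ N → |diffOp V w g x| ≤ M') :
    |expansion V a (fun y => f y * g y) x - expansion V a f x * expansion V a g x| ≤
      ((words ℓ N ×ˢ words ℓ N).card * (B * B * H ^ (2 * N) * (M * M'))) * h ^ (N + 1) := by
  have e : expansion V a f x * expansion V a g x =
      ∑ q ∈ words ℓ N ×ˢ words ℓ N,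
        a.coeff q.1 * a.coeff q.2 * (diffOp V q.1 f x * diffOp V q.2 g x) := by
    rw [expansion, expansion, Finset.sum_mul_sum, ← Finset.sum_product']
    refine Finset.sum_congr rfl fun q _ => ?_
    simp only [smul_eq_mul]
    ring
  -- Only the pairs of total length above `N` remain.
  rw [expansion_mul hV hf hg hgl, e, ← Finset.sum_filter_add_sum_filter_not
    (words ℓ N ×ˢ words ℓ N) (fun q => q.1.length + q.2.length ≤ N), sub_add_cancel_left, abs_neg,
    mul_assoc, ← nsmul_eq_mul]
  refine (Finset.abs_sum_le_sum_abs _ _).trans ((Finset.sum_le_card_nsmul _ _ _ fun q hq => ?_).trans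
    (nsmul_le_nsmul_left (by positivity) (Finset.card_filter_le _ _)))
  obtain ⟨u, v⟩ := q
  simp only [Finset.mem_filter, Finset.mem_product, mem_words, not_le] at hq
  obtain ⟨⟨hu, hv⟩, huv⟩ := hq
  -- A factor `h ^ (N + 1)` is extracted, and the excess power of `h` is absorbed by `H`.
  have h1 : h ^ u.length * h ^ v.length ≤ H ^ (2 * N) * h ^ (N + 1) := by
    obtain ⟨m, hm⟩ := Nat.exists_eq_add_of_le (Nat.succ_le_of_lt huv)
    rw [← pow_add, hm, Nat.succ_eq_add_one, pow_add, mul_comm]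
    refine mul_le_mul_of_nonneg_right ?_ (by positivity)
    exact (pow_le_pow_left₀ h0 hh _).trans (pow_le_pow_right₀ hH (by omega))
  calc |a.coeff u * a.coeff v * (diffOp V u f x * diffOp V v g x)|
      = |a.coeff u| * |a.coeff v| * (|diffOp V u f x| * |diffOp V v g x|) := by
        simp only [abs_mul]
    _ ≤ (B * h ^ u.length) * (B * h ^ v.length) * (M * M') := by
        gcongr
        · exact ha u
        · exact ha v
        · exact hfM u hu
        · exact hgM v hv
    _ = B * B * (h ^ u.length * h ^ v.length) * (M * M') := by ring
    _ ≤ B * B * (H ^ (2 * N) * h ^ (N + 1)) * (M * M') := by gcongr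
    _ = B * B * H ^ (2 * N) * (M * M') * h ^ (N + 1) := by ring

/-- Induction on the number of factors. The bound on the derivatives of the product is carried along
because multiplying by one more factor needs it. The constant must not depend on the factors, the
point, the tensor or `h`. -/
theorem exists_expansion_prod_bound (hV : ∀ i, ContDiff ℝ N (V i)) {B H M : ℝ} (hM : 0 ≤ M)
    (hB : 0 ≤ B) (hH : 1 ≤ H) (j : ℕ) :
    ∃ C : ℝ, 0 ≤ C ∧ ∀ (q : Fin j → E → ℝ) (x : E), (∀ m, ContDiff ℝ N (q m)) →
      (∀ m, ∀ w : List (Fin ℓ), w.length ≤ N → |diffOp V w (q m) x| ≤ M) →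
      (∀ w : List (Fin ℓ), w.length ≤ N → |diffOp V w (fun y => ∏ m, q m y) x| ≤ C) ∧
      ∀ (a : TruncTensor ℓ N) (h : ℝ), IsGroupLike a → 0 ≤ h → h ≤ H →
        (∀ w, |a.coeff w| ≤ B * h ^ w.length) →
        |expansion V a (fun y => ∏ m, q m y) x - ∏ m, expansion V a (q m) x| ≤
          C * h ^ (N + 1) := by
  induction j with
  | zero =>
    refine ⟨1, zero_le_one, fun q x _ _ => ⟨fun w _ => ?_, fun a h hgl h0 _ _ => ?_⟩⟩
    · simp only [Finset.univ_eq_empty, Finset.prod_empty, diffOp_const]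
      split_ifs <;> simp
    · simp only [Finset.univ_eq_empty, Finset.prod_empty, expansion_const hgl.coeff_nil, sub_self,
        abs_zero]
      positivity
  | succ j ih =>
    obtain ⟨C, hC, ih⟩ := ih
    set C₁ : ℝ := (words ℓ N ×ˢ words ℓ N).card * (B * B * H ^ (2 * N) * (M * C)) with hC₁
    set C₂ : ℝ := (words ℓ N).card * (B * H ^ N * M) with hC₂
    have hC₁0 : 0 ≤ C₁ := by positivity
    have hC₂0 : 0 ≤ C₂ := by positivity
    -- The terms come from the Leibniz rule, from the multiplicativity defect of the last product,
    -- and from the earlier defect multiplied by the expansion of the new factor.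
    refine ⟨2 ^ N * (M * C) + (C₁ + C₂ * C), by positivity, fun q x hq hqM => ?_⟩
    have hprod : ContDiff ℝ N (fun y => ∏ m : Fin j, q m.succ y) :=
      contDiff_prod fun m _ => hq m.succ
    obtain ⟨ih1, ih2⟩ := ih (fun m => q m.succ) x (fun m => hq m.succ) (fun m => hqM m.succ)
    simp only [Fin.prod_univ_succ]
    refine ⟨fun w hw => ?_, fun a h hgl h0 hh ha => ?_⟩
    · rw [diffOp_mul hV (hq 0) hprod hw]
      refine (abs_unshuffleSum_le (M := M * C) w fun u v hu hv => ?_).trans ?_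
      · rw [abs_mul]
        exact mul_le_mul (hqM 0 u (hu.trans hw)) (ih1 v (hv.trans hw)) (abs_nonneg _) hM
      · have : (2 : ℝ) ^ w.length ≤ 2 ^ N := pow_le_pow_right₀ (by norm_num) hw
        have := mul_le_mul_of_nonneg_right this (mul_nonneg hM hC)
        have : 0 ≤ C₂ * C := by positivity
        linarith
    · have h1 := abs_expansion_mul_sub_le hV (hq 0) hprod hgl hM hC hB hH h0 hh ha (hqM 0) ih1
      have h2 := abs_expansion_le (V := V) hB hH h0 hh ha (hqM 0)
      have h3 := ih2 a h hgl h0 hh ha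
      have h4 : |expansion V a (q 0) x * expansion V a (fun y => ∏ m : Fin j, q m.succ y) x -
          expansion V a (q 0) x * ∏ m : Fin j, expansion V a (q m.succ) x| ≤
          C₂ * (C * h ^ (N + 1)) := by
        rw [← mul_sub, abs_mul]
        exact mul_le_mul h2 h3 (abs_nonneg _) hC₂0
      have h5 : 0 ≤ 2 ^ N * (M * C) * h ^ (N + 1) := by positivity
      refine (abs_sub_le _ _ _).trans ((add_le_add h1 h4).trans ?_)
      linarith

end Expansion

/-! ### Symmetry of higher derivatives -/

section Symmetry

variable {E F : Type*} [NormedAddCommGroup E] [NormedSpace ℝ E] [NormedAddCommGroup F]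
  [NormedSpace ℝ F]

theorem iteratedFDeriv_succ_succ_apply {m : ℕ} {f : E → F} (hf : ContDiff ℝ (m + 2 : ℕ) f) (x : E)
    (v : Fin (m + 2) → E) :
    iteratedFDeriv ℝ (m + 2) f x v =
      fderiv ℝ (fderiv ℝ (iteratedFDeriv ℝ m f)) x (v 0) (v 1) (fun k => v k.succ.succ) := by
  have h2 : ContDiff ℝ 2 (iteratedFDeriv ℝ m f) :=
    hf.iteratedFDeriv_right (by rw [add_comm]; norm_cast)
  have h1 : ContDiff ℝ 1 (iteratedFDeriv ℝ (m + 1) f) :=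
    hf.iteratedFDeriv_right (by norm_cast; omega)
  have hd : DifferentiableAt ℝ (fderiv ℝ (iteratedFDeriv ℝ m f)) x :=
    (h2.fderiv_right (m := 1) (by norm_num [one_add_one_eq_two])).differentiable (by norm_num) x
  rw [iteratedFDeriv_succ_apply_left, ← fderiv_continuousMultilinear_apply_const_apply
    (h1.differentiable (by norm_num) x)]
  simp only [iteratedFDeriv_succ_apply_left]
  have h := hd.hasFDerivAt.clm_apply (hasFDerivAt_const (Fin.tail v 0) x)
  rw [fderiv_continuousMultilinear_apply_const_apply h.differentiableAt, h.fderiv]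
  simp
  rfl

/-- The first two slots are exchanged by the symmetry of the second derivative of a lower-order
derivative; the other adjacent swaps follow by differentiating the identity one order below. -/
theorem iteratedFDeriv_comp_swap {n : ℕ} {f : E → F} (hf : ContDiff ℝ (n + 1 : ℕ) f) (x : E)
    (i : Fin n) (v : Fin (n + 1) → E) :
    iteratedFDeriv ℝ (n + 1) f x (v ∘ Equiv.swap i.castSucc i.succ) =
      iteratedFDeriv ℝ (n + 1) f x v := by
  induction n generalizing x with
  | zero => exact i.elim0
  | succ n ih =>
    refine Fin.cases ?_ (fun k => ?_) i
    · rw [iteratedFDeriv_succ_succ_apply hf, iteratedFDeriv_succ_succ_apply hf]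
      have h2 : ContDiff ℝ 2 (iteratedFDeriv ℝ n f) :=
        hf.iteratedFDeriv_right (by rw [add_comm]; norm_cast)
      have hs : IsSymmSndFDerivAt ℝ (iteratedFDeriv ℝ n f) x :=
        h2.contDiffAt.isSymmSndFDerivAt (by simp)
      have e0 : (v ∘ Equiv.swap (Fin.castSucc (0 : Fin (n + 1))) (Fin.succ 0)) 0 = v 1 := by
        simp
      have e1 : (v ∘ Equiv.swap (Fin.castSucc (0 : Fin (n + 1))) (Fin.succ 0)) 1 = v 0 := by
        simp
      have e2 : (fun k : Fin n => (v ∘ Equiv.swap (Fin.castSucc (0 : Fin (n + 1))) (Fin.succ 0))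
          k.succ.succ) = fun k => v k.succ.succ := by
        funext k
        rw [Function.comp_apply, Equiv.swap_apply_of_ne_of_ne]
        · simp [Fin.ext_iff]
        · simp [Fin.ext_iff]
      rw [e0, e1, e2, hs.eq]
    · have hd : DifferentiableAt ℝ (iteratedFDeriv ℝ (n + 1) f) x :=
        (hf.iteratedFDeriv_right (m := 1) (by norm_cast; omega)).differentiable (by norm_num) x
      have hf' : ContDiff ℝ (n + 1 : ℕ) f := hf.of_le (by norm_cast; omega)
      rw [iteratedFDeriv_succ_apply_left, iteratedFDeriv_succ_apply_left,
        ← fderiv_continuousMultilinear_apply_const_apply hd,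
        ← fderiv_continuousMultilinear_apply_const_apply hd]
      have e0 : (v ∘ Equiv.swap k.succ.castSucc k.succ.succ) 0 = v 0 := by
        rw [Function.comp_apply, Equiv.swap_apply_of_ne_of_ne]
        · simp [Fin.ext_iff]
        · simp [Fin.ext_iff]
      have e1 : Fin.tail (v ∘ Equiv.swap k.succ.castSucc k.succ.succ) =
          Fin.tail v ∘ Equiv.swap k.castSucc k.succ := by
        funext j
        simp only [Fin.tail, Function.comp_apply, ← Fin.succ_castSucc]
        rw [← (Fin.succ_injective _).map_swap]
      rw [e0, e1]
      simp only [ih hf']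

/-- The `n`-th derivative of a function of class `C^n` is symmetric. -/
theorem iteratedFDeriv_comp_perm {n : ℕ} {f : E → F} (hf : ContDiff ℝ n f) (x : E)
    (v : Fin n → E) (σ : Equiv.Perm (Fin n)) :
    iteratedFDeriv ℝ n f x (v ∘ σ) = iteratedFDeriv ℝ n f x v := by
  cases n with
  | zero => rw [Subsingleton.elim (v ∘ σ) v]
  | succ n =>
    have hσ : σ ∈ Submonoid.closure
        (Set.range fun i : Fin n => Equiv.swap i.castSucc i.succ) := by
      rw [Equiv.Perm.mclosure_swap_castSucc_succ]
      trivial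
    induction hσ using Submonoid.closure_induction generalizing v with
    | mem τ h =>
      obtain ⟨i, rfl⟩ := h
      exact iteratedFDeriv_comp_swap hf x i v
    | one => rfl
    | mul τ ρ _ _ hτ hρ =>
      rw [Equiv.Perm.coe_mul, ← Function.comp_assoc, hρ, hτ]

end Symmetry

/-! ### Taylor polynomials in several variables -/

section TaylorPolynomial

variable {E F : Type*} [NormedAddCommGroup E] [NormedSpace ℝ E] [NormedAddCommGroup F]
  [NormedSpace ℝ F]

theorem contDiff_diagonal {j : ℕ} {n : WithTop ℕ∞} (q : E [×j]→L[ℝ] F) (x : E) :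
    ContDiff ℝ n (fun y => q (fun _ => y - x)) :=
  q.contDiff.comp (contDiff_pi.2 fun _ => contDiff_id.sub contDiff_const)

theorem iteratedFDeriv_diagonal_self {j : ℕ} (q : E [×j]→L[ℝ] F) (x y : E) (v : Fin j → E) :
    iteratedFDeriv ℝ j (fun y => q (fun _ => y - x)) y v =
      ∑ σ : Equiv.Perm (Fin j), q (v ∘ σ) := by
  rw [iteratedFDeriv_comp_sub (f := fun z => q (fun _ => z))]
  exact q.iteratedFDeriv_comp_diagonal _ v

/-- The embedding records which slots of `q` receive the directions; the others keep `y - x`. Hence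
there is no term when `m > j`, and every term vanishes at `y = x` when `m < j`. -/
theorem iteratedFDeriv_diagonal_apply {j : ℕ} (q : E [×j]→L[ℝ] F) (m : ℕ) (x y : E)
    (v : Fin m → E) :
    iteratedFDeriv ℝ m (fun y => q (fun _ => y - x)) y v =
      ∑ e : Fin m ↪ Fin j, q.iteratedFDerivComponent e.toEquivRange
        (fun _ => y - x) (fun i _ => v i) := by
  let g : E →L[ℝ] (Fin j → E) := ContinuousLinearMap.pi (fun _ => ContinuousLinearMap.id ℝ E)
  rw [iteratedFDeriv_comp_sub (f := fun z => q (fun _ => z))]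
  change iteratedFDeriv ℝ m (q ∘ g) (y - x) v = _
  rw [ContinuousLinearMap.iteratedFDeriv_comp_right _ q.contDiff _ le_rfl, q.iteratedFDeriv_eq]
  simp [ContinuousMultilinearMap.iteratedFDeriv, g]
  congr!

theorem iteratedFDeriv_diagonal_of_gt {j m : ℕ} (q : E [×j]→L[ℝ] F) (h : j < m) (x y : E) :
    iteratedFDeriv ℝ m (fun y => q (fun _ => y - x)) y = 0 := by
  ext v
  have : IsEmpty (Fin m ↪ Fin j) :=
    ⟨fun e => absurd (Fintype.card_le_of_embedding e) (by simpa using h)⟩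
  rw [iteratedFDeriv_diagonal_apply, Finset.univ_eq_empty, Finset.sum_empty]
  rfl

theorem iteratedFDeriv_diagonal_of_lt {j m : ℕ} (q : E [×j]→L[ℝ] F) (h : m < j) (x : E) :
    iteratedFDeriv ℝ m (fun y => q (fun _ => y - x)) x = 0 := by
  ext v
  rw [iteratedFDeriv_diagonal_apply]
  refine Finset.sum_eq_zero fun e _ => ?_
  rw [ContinuousMultilinearMap.iteratedFDerivComponent_apply]
  obtain ⟨i, hi⟩ : ∃ i, i ∉ Set.range e := by
    by_contra! hs
    have := Fintype.card_le_of_surjective e hs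
    simp only [Fintype.card_fin] at this
    omega
  refine q.map_coord_zero i ?_
  rw [dif_neg hi, sub_self]

/-- The Taylor polynomial of order `n` of `f` at `x`. -/
def taylorPolynomial (n : ℕ) (f : E → F) (x y : E) : F :=
  ∑ j ∈ Finset.range (n + 1),
    ((j.factorial : ℝ)⁻¹ • iteratedFDeriv ℝ j f x) (fun _ => y - x)

theorem contDiff_taylorPolynomial {n : ℕ} {m : WithTop ℕ∞} (f : E → F) (x : E) :
    ContDiff ℝ m (taylorPolynomial n f x) :=
  ContDiff.sum fun _ _ => contDiff_diagonal _ x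

theorem iteratedFDeriv_diagonal_iteratedFDeriv {j : ℕ} {f : E → F} (hf : ContDiff ℝ j f)
    (x y : E) :
    iteratedFDeriv ℝ j
      (fun y => ((j.factorial : ℝ)⁻¹ • iteratedFDeriv ℝ j f x) (fun _ => y - x)) y =
      iteratedFDeriv ℝ j f x := by
  ext v
  rw [iteratedFDeriv_diagonal_self]
  simp only [smul_apply, iteratedFDeriv_comp_perm hf, Finset.sum_const, Finset.card_univ,
    Fintype.card_perm, Fintype.card_fin]
  rw [← Nat.cast_smul_eq_nsmul ℝ, smul_smul, mul_inv_cancel₀ (by positivity), one_smul]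

theorem iteratedFDeriv_taylorPolynomial {n m : ℕ} (f : E → F) (x y : E) :
    iteratedFDeriv ℝ m (taylorPolynomial n f x) y = ∑ j ∈ Finset.range (n + 1),
      iteratedFDeriv ℝ m
        (fun y => ((j.factorial : ℝ)⁻¹ • iteratedFDeriv ℝ j f x) (fun _ => y - x)) y := by
  have h := iteratedFDeriv_sum (𝕜 := ℝ) (i := m) (u := Finset.range (n + 1))
    (f := fun j y => ((j.factorial : ℝ)⁻¹ • iteratedFDeriv ℝ j f x) (fun _ => y - x))
    fun j _ => contDiff_diagonal _ x
  have h' := congrFun h y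
  rw [Finset.sum_apply] at h'
  exact h'

theorem iteratedFDeriv_taylorPolynomial_base {n m : ℕ} {f : E → F} (hf : ContDiff ℝ n f)
    (hm : m ≤ n) (x : E) :
    iteratedFDeriv ℝ m (taylorPolynomial n f x) x = iteratedFDeriv ℝ m f x := by
  rw [iteratedFDeriv_taylorPolynomial, Finset.sum_eq_single m]
  · exact iteratedFDeriv_diagonal_iteratedFDeriv (hf.of_le (by exact_mod_cast hm)) x x
  · intro j _ hj
    rcases lt_or_gt_of_ne hj with h | h
    · exact iteratedFDeriv_diagonal_of_gt _ h x x
    · exact iteratedFDeriv_diagonal_of_lt _ h x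
  · intro h
    simp only [Finset.mem_range] at h
    omega

theorem iteratedFDeriv_taylorPolynomial_top {n : ℕ} {f : E → F} (hf : ContDiff ℝ n f) (x y : E) :
    iteratedFDeriv ℝ n (taylorPolynomial n f x) y = iteratedFDeriv ℝ n f x := by
  rw [iteratedFDeriv_taylorPolynomial, Finset.sum_eq_single n]
  · exact iteratedFDeriv_diagonal_iteratedFDeriv hf x y
  · intro j hj hjn
    rw [Finset.mem_range] at hj
    exact iteratedFDeriv_diagonal_of_gt _ (by omega) x y
  · simp

/-- Descent from the top derivative by the mean value inequality: each lower derivative vanishes at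
`x`, which gains a factor `r`. -/
theorem norm_le_of_iteratedFDeriv_eq_zero {E F : Type*} [NormedAddCommGroup E] [NormedSpace ℝ E]
    [NormedAddCommGroup F] [NormedSpace ℝ F] {n : ℕ} {g : E → F} (hg : ContDiff ℝ n g) {x : E}
    (hx : ∀ j < n, iteratedFDeriv ℝ j g x = 0) {r C : ℝ}
    (hC : ∀ y ∈ Metric.closedBall x r, ‖iteratedFDeriv ℝ n g y‖ ≤ C)
    {y : E} (hy : y ∈ Metric.closedBall x r) : ‖g y‖ ≤ C * r ^ n := by
  have hr : 0 ≤ r := dist_nonneg.trans hy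
  have hC0 : 0 ≤ C := (norm_nonneg _).trans (hC x (Metric.mem_closedBall_self hr))
  have key : ∀ k ≤ n, ∀ y ∈ Metric.closedBall x r, ‖iteratedFDeriv ℝ (n - k) g y‖ ≤ C * r ^ k := by
    intro k
    induction k with
    | zero => simpa using hC
    | succ k ih =>
      intro hk y hy
      have hd : Differentiable ℝ (iteratedFDeriv ℝ (n - (k + 1)) g) :=
        (hg.iteratedFDeriv_right (m := 1) (by norm_cast; omega)).differentiable (by norm_num)
      have h := (convex_closedBall x r).norm_image_sub_le_of_norm_fderiv_le (𝕜 := ℝ)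
        (C := C * r ^ k) (fun w _ => hd w) (fun w hw => ?_) (Metric.mem_closedBall_self hr) hy
      · rw [hx _ (by omega), sub_zero] at h
        refine h.trans ?_
        rw [pow_succ, ← mul_assoc, ← dist_eq_norm]
        exact mul_le_mul_of_nonneg_left hy (by positivity)
      · rw [norm_fderiv_iteratedFDeriv]
        have e : n - (k + 1) + 1 = n - k := by omega
        rw [e]
        exact ih (by omega) w hw
  have h := key n le_rfl y hy
  rwa [Nat.sub_self, norm_iteratedFDeriv_zero] at h

/-- Taylor's theorem for a function whose `n`-th derivative is close to its value at `x`. -/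
theorem norm_sub_taylorPolynomial_le {n : ℕ} {f : E → F} (hf : ContDiff ℝ n f) {x y : E} {C : ℝ}
    (hC : ∀ w ∈ Metric.closedBall x ‖y - x‖,
      ‖iteratedFDeriv ℝ n f w - iteratedFDeriv ℝ n f x‖ ≤ C) :
    ‖f y - taylorPolynomial n f x y‖ ≤ C * ‖y - x‖ ^ n := by
  have hP : ContDiff ℝ n (taylorPolynomial n f x) := contDiff_taylorPolynomial f x
  have hle : ∀ {j : ℕ}, j ≤ n → ((j : ℕ) : WithTop ℕ∞) ≤ n := fun h => by exact_mod_cast h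
  refine norm_le_of_iteratedFDeriv_eq_zero (g := f - taylorPolynomial n f x) (x := x)
    (r := ‖y - x‖) (hf.sub hP)
    (fun j hj => ?_) (fun w hw => ?_) (by simp [dist_eq_norm])
  · rw [iteratedFDeriv_sub_apply (hf.of_le (hle hj.le)).contDiffAt
      (hP.of_le (hle hj.le)).contDiffAt, iteratedFDeriv_taylorPolynomial_base hf hj.le, sub_self]
  · rw [iteratedFDeriv_sub_apply hf.contDiffAt hP.contDiffAt,
      iteratedFDeriv_taylorPolynomial_top hf]
    exact hC w hw

/-- Both functions have the same `N`-jet at `x`. -/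
theorem expansion_taylorPolynomial {ℓ N : ℕ} {V : Fin ℓ → E → E} (hV : ∀ i, ContDiff ℝ N (V i))
    {f : E → F} (hf : ContDiff ℝ N f) (a : TruncTensor ℓ N) (x : E) :
    expansion V a (taylorPolynomial N f x) x = expansion V a f x := by
  have hP : ContDiff ℝ N (taylorPolynomial N f x) := contDiff_taylorPolynomial f x
  have h : expansion V a (fun y => f y - taylorPolynomial N f x y) x = 0 := by
    refine Finset.sum_eq_zero fun w hw => ?_
    rw [diffOp_eq_zero_of_iteratedFDeriv_eq_zero hV (hf.sub hP) (fun j hj => ?_)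
      (mem_words.mp hw), smul_zero]
    have hle : ((j : ℕ) : WithTop ℕ∞) ≤ N := by exact_mod_cast hj
    have h' := iteratedFDeriv_sub_apply (hf.of_le hle).contDiffAt (hP.of_le hle).contDiffAt (x := x)
    rw [iteratedFDeriv_taylorPolynomial_base hf hj, sub_self] at h'
    exact h'
  rw [expansion_sub hV hf hP, sub_eq_zero] at h
  exact h.symm

end TaylorPolynomial

/-! ### Functions of class `C^γ` and uniform Taylor remainders -/

section Holder

variable {E F : Type*} [NormedAddCommGroup E] [NormedSpace ℝ E] [NormedAddCommGroup F]
  [NormedSpace ℝ F] {γ : ℝ}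

theorem le_ceil_sub_one {n : ℕ} (h : (n : ℝ) < γ) : n ≤ ⌈γ⌉₊ - 1 := by
  have := Nat.lt_ceil.mpr h
  omega

theorem ceil_sub_one_lt (hγ : 0 < γ) : ((⌈γ⌉₊ - 1 : ℕ) : ℝ) < γ := by
  have h1 := Nat.ceil_pos.mpr hγ
  have h2 := Nat.ceil_lt_add_one hγ.le
  rw [Nat.cast_sub h1]
  push_cast
  linarith

theorem le_ceil_sub_one_add_one (hγ : 0 < γ) : γ ≤ ((⌈γ⌉₊ - 1 : ℕ) : ℝ) + 1 := by
  have h1 := Nat.ceil_pos.mpr hγ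
  have h2 := Nat.le_ceil γ
  rw [Nat.cast_sub h1]
  push_cast
  linarith

theorem IsClassC.contDiff_of_lt {g : E → F} (hg : IsClassC γ g) {n : ℕ} (h : (n : ℝ) < γ) :
    ContDiff ℝ n g :=
  hg.1.of_le (by exact_mod_cast le_ceil_sub_one h)

theorem exists_local_lipschitz_iteratedFDeriv {g : E → F} {n : ℕ}
    (hg : ContDiff ℝ (n + 1 : ℕ) g) (x : E) :
    ∃ r > 0, ∃ C : ℝ, 0 ≤ C ∧ ∀ y ∈ Metric.ball x r, ∀ y' ∈ Metric.ball x r,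
      ‖iteratedFDeriv ℝ n g y - iteratedFDeriv ℝ n g y'‖ ≤ C * ‖y - y'‖ := by
  have h1 : ContDiff ℝ 1 (iteratedFDeriv ℝ n g) :=
    hg.iteratedFDeriv_right (by norm_cast; omega)
  obtain ⟨K, t, ht, hK⟩ := h1.locallyLipschitz x
  obtain ⟨r, hr, hrt⟩ := Metric.mem_nhds_iff.mp ht
  refine ⟨r, hr, K, K.2, fun y hy y' hy' => ?_⟩
  rw [← dist_eq_norm, ← dist_eq_norm]
  exact hK.dist_le_mul y (hrt hy) y' (hrt hy')

theorem isClassC_of_contDiff {g : E → F} (hγ : 0 < γ) (hg : ∀ n : ℕ, ContDiff ℝ n g) :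
    IsClassC γ g := by
  refine ⟨hg _, fun x => ?_⟩
  obtain ⟨r, hr, C, hC0, hC⟩ := exists_local_lipschitz_iteratedFDeriv (hg (⌈γ⌉₊ - 1 + 1)) x
  -- Radius at most `1/2` keeps distances below 1, where a Lipschitz bound implies every Hölder
  -- bound of exponent at most 1.
  refine ⟨min r (1 / 2), by positivity, C, fun y hy y' hy' => ?_⟩
  refine (hC y (Metric.ball_subset_ball (min_le_left _ _) hy) y'
    (Metric.ball_subset_ball (min_le_left _ _) hy')).trans (mul_le_mul_of_nonneg_left ?_ hC0)
  have h1 : ‖y - y'‖ ≤ 1 := by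
    have a1 := Metric.ball_subset_ball (min_le_right _ _) hy
    have a2 := Metric.ball_subset_ball (min_le_right _ _) hy'
    rw [Metric.mem_ball] at a1 a2
    rw [← dist_eq_norm]
    linarith [dist_triangle_right y y' x]
  have h2 := ceil_sub_one_lt hγ
  have h3 := le_ceil_sub_one_add_one hγ
  calc ‖y - y'‖ = ‖y - y'‖ ^ (1 : ℝ) := (Real.rpow_one _).symm
    _ ≤ _ := Real.rpow_le_rpow_of_exponent_ge_of_imp (norm_nonneg _) h1 (by linarith)
        (fun _ h => by linarith)

/-- If `n` is the top order, this is the definition; below it the `n`-th derivative is `C^1`, hence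
locally Lipschitz, which explains the minimum with 1. -/
theorem IsClassC.exists_local_holder {g : E → F} (hg : IsClassC γ g) {n : ℕ} (hn : (n : ℝ) < γ)
    (x : E) : ∃ r > 0, ∃ C : ℝ, ∀ y ∈ Metric.ball x r, ∀ y' ∈ Metric.ball x r,
      ‖iteratedFDeriv ℝ n g y - iteratedFDeriv ℝ n g y'‖ ≤ C * ‖y - y'‖ ^ min (γ - n) 1 := by
  have hγ : 0 < γ := n.cast_nonneg.trans_lt hn
  rcases (le_ceil_sub_one hn).eq_or_lt with h | h
  · have h1 := le_ceil_sub_one_add_one hγ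
    rw [← h] at h1
    have h2 := hg.2 x
    rw [← h] at h2
    rwa [min_eq_left (by linarith)]
  · obtain ⟨r, hr, C, _, hC⟩ := exists_local_lipschitz_iteratedFDeriv
      (hg.1.of_le (by exact_mod_cast h) : ContDiff ℝ (n + 1 : ℕ) g) x
    have h1 := ceil_sub_one_lt hγ
    have h2 : (n : ℝ) + 1 ≤ ((⌈γ⌉₊ - 1 : ℕ) : ℝ) := by exact_mod_cast h
    refine ⟨r, hr, C, fun y hy y' hy' => ?_⟩
    rw [min_eq_right (by linarith), Real.rpow_one]
    exact hC y hy y' hy'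

/-- A continuous function that is locally Hölder continuous is Hölder continuous on compact
sets. -/
theorem exists_holder_of_isCompact {E F : Type*} [NormedAddCommGroup E]
    [NormedAddCommGroup F] {D : E → F} (hD : Continuous D) {β : ℝ}
    (hloc : ∀ x, ∃ r > 0, ∃ C : ℝ, ∀ y ∈ Metric.ball x r, ∀ y' ∈ Metric.ball x r,
      ‖D y - D y'‖ ≤ C * ‖y - y'‖ ^ β) (hβ : 0 < β) {K : Set E} (hK : IsCompact K) :
    ∃ C : ℝ, ∀ y ∈ K, ∀ y' ∈ K, ‖D y - D y'‖ ≤ C * ‖y - y'‖ ^ β := by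
  have key : ∃ C : ℝ, ∀ q ∈ K ×ˢ K, ‖D q.1 - D q.2‖ ≤ C * ‖q.1 - q.2‖ ^ β := by
    refine (hK.prod hK).induction_on
      (p := fun S => ∃ C : ℝ, ∀ q ∈ S, ‖D q.1 - D q.2‖ ≤ C * ‖q.1 - q.2‖ ^ β)
      ⟨0, by simp⟩ ?_ ?_ ?_
    · rintro s t hst ⟨C, hC⟩
      exact ⟨C, fun q hq => hC q (hst hq)⟩
    · rintro s t ⟨C, hC⟩ ⟨C', hC'⟩
      refine ⟨max C C', fun q hq => ?_⟩
      rcases hq with hq | hq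
      · exact (hC q hq).trans (mul_le_mul_of_nonneg_right (le_max_left _ _) (by positivity))
      · exact (hC' q hq).trans (mul_le_mul_of_nonneg_right (le_max_right _ _) (by positivity))
    · rintro ⟨y, y'⟩ _
      rcases eq_or_ne y y' with rfl | hne
      · obtain ⟨r, hr, C, hC⟩ := hloc y
        refine ⟨Metric.ball y r ×ˢ Metric.ball y r, mem_nhdsWithin_of_mem_nhds
          (prod_mem_nhds (Metric.ball_mem_nhds y hr) (Metric.ball_mem_nhds y hr)), C, ?_⟩
        rintro ⟨u, v⟩ ⟨hu, hv⟩
        exact hC u hu v hv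
      · have hpos : 0 < ‖y - y'‖ ^ β := Real.rpow_pos_of_pos (norm_pos_iff.mpr (sub_ne_zero.mpr hne)) _
        -- Off the diagonal, the `+ 1` makes the inequality strict at the given pair, so it persists
        -- nearby by continuity.
        set c : ℝ := (‖D y - D y'‖ + 1) / ‖y - y'‖ ^ β with hc
        have h1 : Continuous fun q : E × E => ‖D q.1 - D q.2‖ := by fun_prop
        have h2 : Continuous fun q : E × E => c * ‖q.1 - q.2‖ ^ β :=
          continuous_const.mul ((by fun_prop : Continuous fun q : E × E => ‖q.1 - q.2‖).rpow_const
            fun _ => Or.inr hβ.le)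
        have h3 : ‖D y - D y'‖ < c * ‖y - y'‖ ^ β := by
          rw [hc, div_mul_cancel₀ _ hpos.ne']
          linarith
        refine ⟨{q : E × E | ‖D q.1 - D q.2‖ < c * ‖q.1 - q.2‖ ^ β}, mem_nhdsWithin_of_mem_nhds
          ((isOpen_lt h1 h2).mem_nhds h3), c, fun q hq => le_of_lt hq⟩
  obtain ⟨C, hC⟩ := key
  exact ⟨C, fun y hy y' hy' => hC (y, y') ⟨hy, hy'⟩⟩

/-- Uniform Taylor estimate on balls for functions of class `C^γ`. -/
theorem IsClassC.exists_taylor_bound [ProperSpace E] {f : E → F} (hf : IsClassC γ f) {n : ℕ}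
    (hn : (n : ℝ) < γ) (R : ℝ) : ∃ C : ℝ, 0 ≤ C ∧ ∀ x y : E, ‖x‖ ≤ R → ‖y‖ ≤ R →
      ‖f y - taylorPolynomial n f x y‖ ≤ C * (‖y - x‖ ^ min (γ - n) 1 * ‖y - x‖ ^ n) := by
  have hβ : 0 < min (γ - n) 1 := lt_min (by linarith) one_pos
  obtain ⟨C, hC⟩ := exists_holder_of_isCompact
    (hf.1.continuous_iteratedFDeriv (by exact_mod_cast le_ceil_sub_one hn))
    -- Radius `3 * R` contains the ball about `x` of radius `‖y - x‖ ≤ 2 * R`.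
    (hf.exists_local_holder hn) hβ (isCompact_closedBall (0 : E) (3 * R))
  refine ⟨max C 0, le_max_right _ _, fun x y hx hy => ?_⟩
  rw [← mul_assoc]
  refine norm_sub_taylorPolynomial_le (hf.contDiff_of_lt hn) fun w hw => ?_
  rw [mem_closedBall_iff_norm] at hw
  have hyx : ‖y - x‖ ≤ 2 * R := (norm_sub_le _ _).trans (by linarith)
  have hw3 : ‖w‖ ≤ 3 * R := by
    calc ‖w‖ = ‖(w - x) + x‖ := by rw [sub_add_cancel]
      _ ≤ 3 * R := (norm_add_le _ _).trans (by linarith)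
  have hR : 0 ≤ R := (norm_nonneg x).trans hx
  refine (hC w (by simpa using hw3) x (by simp; linarith)).trans ?_
  have h1 : ‖w - x‖ ^ min (γ - n) 1 ≤ ‖y - x‖ ^ min (γ - n) 1 :=
    Real.rpow_le_rpow (norm_nonneg _) hw hβ.le
  exact (mul_le_mul_of_nonneg_right (le_max_left C 0) (by positivity)).trans
    (mul_le_mul_of_nonneg_left h1 (le_max_right _ _))

end Holder

/-! ### Monomials in centred coordinates -/

section Coordinates

variable {d : ℕ}

/-- The Taylor polynomial in coordinates. -/
theorem taylorPolynomial_eq_sum_prod (n : ℕ) (f : EuclideanSpace ℝ (Fin d) → ℝ)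
    (x y : EuclideanSpace ℝ (Fin d)) :
    taylorPolynomial n f x y = ∑ j ∈ Finset.range (n + 1), ∑ r : Fin j → Fin d,
      ((j.factorial : ℝ)⁻¹ *
        iteratedFDeriv ℝ j f x (fun m => EuclideanSpace.basisFun (Fin d) ℝ (r m))) *
        ∏ m, (y (r m) - x (r m)) := by
  refine Finset.sum_congr rfl fun j _ => ?_
  have h : y - x = ∑ i, (y i - x i) • EuclideanSpace.basisFun (Fin d) ℝ i := by
    have := (EuclideanSpace.basisFun (Fin d) ℝ).sum_repr (y - x)
    simpa using this.symm
  rw [smul_apply, h, ContinuousMultilinearMap.map_sum, Finset.smul_sum]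
  refine Finset.sum_congr rfl fun r _ => ?_
  rw [ContinuousMultilinearMap.map_smul_univ, smul_eq_mul, smul_eq_mul]
  ring

end Coordinates

/-! ### Elementary estimates -/

section Bounds

theorem abs_coeff_le_of_homNorm_le {ℓ N : ℕ} {a : TruncTensor ℓ N} (h1 : a.coeff [] = 1)
    {C h : ℝ} (hC : 1 ≤ C) (h0 : 0 ≤ h) (ha : a.homNorm ≤ C * h) (w : List (Fin ℓ)) :
    |a.coeff w| ≤ C ^ N * h ^ w.length := by
  by_cases hw : w.length ≤ N
  swap
  · rw [TruncTensor.coeff_eq_zero a (not_le.mp hw), abs_zero]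
    positivity
  rcases eq_or_ne w [] with rfl | hne
  · rw [h1, abs_one, List.length_nil, pow_zero, mul_one]
    exact one_le_pow₀ hC
  have hk : 1 ≤ w.length := List.length_pos_iff.mpr hne
  have hl : 0 ≤ a.levelNorm w.length := Real.sqrt_nonneg _
  have h2 : |a.coeff w| ≤ a.levelNorm w.length := by
    refine Real.abs_le_sqrt ?_
    have h := Finset.single_le_sum (f := fun I : Fin w.length → Fin ℓ => a.coeff (List.ofFn I) ^ 2)
      (fun I _ => sq_nonneg _) (Finset.mem_univ w.get)
    simpa using h
  have h3 : a.levelNorm w.length ^ (1 / (w.length : ℝ)) ≤ C * h :=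
    (Finset.single_le_sum (f := fun k : ℕ => a.levelNorm k ^ (1 / (k : ℝ)))
      (fun k _ => Real.rpow_nonneg (Real.sqrt_nonneg _) _)
      (Finset.mem_Icc.mpr ⟨hk, hw⟩)).trans ha
  calc |a.coeff w| ≤ a.levelNorm w.length := h2
    _ = (a.levelNorm w.length ^ (1 / (w.length : ℝ))) ^ w.length := by
        rw [one_div, Real.rpow_inv_natCast_pow hl (by omega)]
    _ ≤ (C * h) ^ w.length := pow_le_pow_left₀ (Real.rpow_nonneg hl _) h3 _
    _ = C ^ w.length * h ^ w.length := mul_pow _ _ _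
    _ ≤ C ^ N * h ^ w.length :=
        mul_le_mul_of_nonneg_right (pow_le_pow_right₀ hC hw) (by positivity)

/-- Only nonempty words occur, so one factor `h` comes out of each term. This yields the
`1/p`-Hölder bound for solutions. -/
theorem norm_taylorSum_le {ℓ N : ℕ} {E F : Type*} [NormedAddCommGroup E] [NormedSpace ℝ E]
    [NormedAddCommGroup F] [NormedSpace ℝ F] {V : Fin ℓ → E → E} {g : E → F} {x : E}
    {a : TruncTensor ℓ N} {B H M h : ℝ} (hB : 0 ≤ B) (hH : 1 ≤ H) (h0 : 0 ≤ h) (hh : h ≤ H)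
    (ha : ∀ w, |a.coeff w| ≤ B * h ^ w.length)
    (hg : ∀ w : List (Fin ℓ), w.length ≤ N → ‖diffOp V w g x‖ ≤ M) :
    ‖taylorSum V a g x‖ ≤
      (∑ k ∈ Finset.Icc 1 N, ∑ _I : Fin k → Fin ℓ, B * H ^ N * M) * h := by
  rw [taylorSum, Finset.sum_mul]
  refine norm_sum_le_of_le _ fun k hk => ?_
  rw [Finset.sum_mul]
  refine norm_sum_le_of_le _ fun I _ => ?_
  obtain ⟨hk1, hkN⟩ := Finset.mem_Icc.mp hk
  have hl : (List.ofFn I).length = k := List.length_ofFn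
  have h1 : h ^ k ≤ H ^ N * h := by
    obtain ⟨m, rfl⟩ := Nat.exists_eq_add_of_le hk1
    rw [add_comm, pow_succ]
    exact mul_le_mul_of_nonneg_right
      ((pow_le_pow_left₀ h0 hh _).trans (pow_le_pow_right₀ hH (by omega))) h0
  have h2 := ha (List.ofFn I)
  rw [hl] at h2
  rw [norm_smul, Real.norm_eq_abs]
  calc |a.coeff (List.ofFn I)| * ‖diffOp V (List.ofFn I) g x‖
      ≤ (B * (H ^ N * h)) * M :=
        mul_le_mul (h2.trans (mul_le_mul_of_nonneg_left h1 hB)) (hg _ (hl.le.trans hkN))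
          (norm_nonneg _) (by positivity)
    _ = B * H ^ N * M * h := by ring

theorem abs_prod_sub_prod_le {j : ℕ} {b c : Fin j → ℝ} {K ε : ℝ} (hK : 1 ≤ K)
    (hb : ∀ m, |b m| ≤ K) (hc : ∀ m, |c m| ≤ K) (hbc : ∀ m, |b m - c m| ≤ ε) (hε : 0 ≤ ε) :
    |∏ m, b m - ∏ m, c m| ≤ j * K ^ j * ε := by
  induction j with
  | zero => simp
  | succ j ih =>
    have h1 := ih (fun m => hb m.succ) (fun m => hc m.succ) fun m => hbc m.succ
    have h2 : |∏ m : Fin j, b m.succ| ≤ K ^ j := by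
      rw [Finset.abs_prod]
      refine (Finset.prod_le_prod (fun _ _ => abs_nonneg _) fun m _ => hb m.succ).trans ?_
      simp
    rw [Fin.prod_univ_succ, Fin.prod_univ_succ]
    have e : b 0 * ∏ m : Fin j, b m.succ - c 0 * ∏ m : Fin j, c m.succ =
        (b 0 - c 0) * ∏ m : Fin j, b m.succ +
          c 0 * (∏ m : Fin j, b m.succ - ∏ m : Fin j, c m.succ) := by ring
    rw [e]
    refine (abs_add_le _ _).trans ?_
    rw [abs_mul, abs_mul]
    have h3 : |b 0 - c 0| * |∏ m : Fin j, b m.succ| ≤ ε * K ^ j :=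
      mul_le_mul (hbc 0) h2 (abs_nonneg _) hε
    have h4 : |c 0| * |∏ m : Fin j, b m.succ - ∏ m : Fin j, c m.succ| ≤ K * (j * K ^ j * ε) :=
      mul_le_mul (hc 0) h1 (abs_nonneg _) (by linarith)
    have h5 : ε * K ^ j ≤ K ^ (j + 1) * ε := by
      rw [mul_comm]
      exact mul_le_mul_of_nonneg_right (pow_le_pow_right₀ hK (Nat.le_succ j)) hε
    push_cast
    calc _ ≤ K ^ (j + 1) * ε + K * (j * K ^ j * ε) := by linarith
      _ = (j + 1) * K ^ (j + 1) * ε := by ring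

theorem rpow_le_mul_rpow {u T b c : ℝ} (h0 : 0 ≤ u) (hu : u ≤ T) (hb : 0 < b) (hbc : b ≤ c) :
    u ^ c ≤ T ^ (c - b) * u ^ b := by
  rcases h0.eq_or_lt with rfl | hpos
  · rw [Real.zero_rpow (by linarith), Real.zero_rpow hb.ne', mul_zero]
  · calc u ^ c = u ^ (c - b) * u ^ b := by rw [← Real.rpow_add hpos, sub_add_cancel]
      _ ≤ T ^ (c - b) * u ^ b :=
        mul_le_mul_of_nonneg_right (Real.rpow_le_rpow h0 hu (by linarith))
          (Real.rpow_nonneg h0 _)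

theorem exists_bound_of_continuous {E F : Type*} [NormedAddCommGroup E] [ProperSpace E]
    [NormedAddCommGroup F] {ι : Type*} (s : Finset ι) {φ : ι → E → F}
    (hφ : ∀ i ∈ s, Continuous (φ i)) (R : ℝ) :
    ∃ M : ℝ, 0 ≤ M ∧ ∀ i ∈ s, ∀ x : E, ‖x‖ ≤ R → ‖φ i x‖ ≤ M := by
  classical
  induction s using Finset.induction_on with
  | empty => exact ⟨0, le_rfl, by simp⟩
  | insert i s _ ih =>
    obtain ⟨M, hM0, hM⟩ := ih fun j hj => hφ j (Finset.mem_insert_of_mem hj)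
    obtain ⟨M', hM'⟩ := (isCompact_closedBall (0 : E) R).exists_bound_of_continuousOn
      (hφ i (Finset.mem_insert_self i s)).continuousOn
    refine ⟨max M M', hM0.trans (le_max_left _ _), fun j hj x hx => ?_⟩
    rcases Finset.mem_insert.mp hj with rfl | hj
    · exact (hM' x (by simpa using hx)).trans (le_max_right _ _)
    · exact (hM j hj x hx).trans (le_max_left _ _)

end Bounds

/-! ### Expansion of a test function along a group-like tensor -/

section Core

variable {d ℓ N : ℕ} {V : Fin ℓ → EuclideanSpace ℝ (Fin d) → EuclideanSpace ℝ (Fin d)}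

theorem expansion_coordinate (hV : ∀ i, ContDiff ℝ N (V i)) {a : TruncTensor ℓ N}
    (ha : a.coeff [] = 1) (x : EuclideanSpace ℝ (Fin d)) (i : Fin d) :
    expansion V a (fun y : EuclideanSpace ℝ (Fin d) => y i) x =
      (x + taylorSum V a (fun y => y) x) i := by
  have h := expansion_clm_comp hV (contDiff_id (n := N))
    (EuclideanSpace.proj i : EuclideanSpace ℝ (Fin d) →L[ℝ] ℝ) a x
  simp only [id_eq] at h
  rw [← expansion_eq ha (fun y => y) x]
  exact h

theorem expansion_centered_coordinate (hV : ∀ i, ContDiff ℝ N (V i)) {a : TruncTensor ℓ N}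
    (ha : a.coeff [] = 1) (x : EuclideanSpace ℝ (Fin d)) (i : Fin d) :
    expansion V a (fun y : EuclideanSpace ℝ (Fin d) => y i - x i) x =
      (x + taylorSum V a (fun y => y) x) i - x i := by
  rw [expansion_sub hV (by fun_prop) contDiff_const, expansion_const ha, expansion_coordinate hV ha]

theorem abs_diffOp_centered_coordinate_le (hV : ∀ i, ContDiff ℝ N (V i))
    (x : EuclideanSpace ℝ (Fin d)) (i : Fin d) {w : List (Fin ℓ)} (hw : w.length ≤ N) :
    |diffOp V w (fun y : EuclideanSpace ℝ (Fin d) => y i - x i) x| ≤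
      ‖diffOp V w (fun y => y) x‖ := by
  rcases eq_or_ne w [] with rfl | hne
  · simp [diffOp]
  · have h := diffOp_clm_comp hV (contDiff_id (n := N))
      (EuclideanSpace.proj i : EuclideanSpace ℝ (Fin d) →L[ℝ] ℝ) hw
    have h' : diffOp V w (fun y : EuclideanSpace ℝ (Fin d) => y i) =
        fun y => (diffOp V w (fun y => y) y) i := h
    rw [diffOp_sub hV (by fun_prop) contDiff_const hw, diffOp_const, h']
    simp only [hne, if_false, sub_zero]
    exact PiLp.norm_apply_le (diffOp V w (fun y => y) x) i

/-- If `y` is close to the truncated expansion of the identity at `x` along a group-like tensor,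
then `f y` is close to the truncated expansion of `f`. -/
theorem exists_expansion_bound {γ : ℝ} (hV : ∀ i, ContDiff ℝ N (V i)) (hN : (N : ℝ) < γ)
    {f : EuclideanSpace ℝ (Fin d) → ℝ} (hf : IsClassC γ f) {B H R : ℝ} (hB : 0 ≤ B)
    (hH : 1 ≤ H) :
    ∃ C : ℝ, 0 ≤ C ∧ ∀ (x y : EuclideanSpace ℝ (Fin d)) (a : TruncTensor ℓ N) (h ε : ℝ),
      ‖x‖ ≤ R → ‖y‖ ≤ R → IsGroupLike a → 0 ≤ h → h ≤ H →
      (∀ w, |a.coeff w| ≤ B * h ^ w.length) →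
      ‖y - (x + taylorSum V a (fun y => y) x)‖ ≤ ε →
      |f y - expansion V a f x| ≤
        C * (‖y - x‖ ^ min (γ - N) 1 * ‖y - x‖ ^ N + (h ^ (N + 1) + ε)) := by
  have hfN : ContDiff ℝ N f := hf.contDiff_of_lt hN
  obtain ⟨M, hM0, hM⟩ := exists_bound_of_continuous (words ℓ N)
    (φ := fun w => diffOp V w (fun y : EuclideanSpace ℝ (Fin d) => y))
    (fun w hw => continuous_diffOp hV contDiff_id (mem_words.mp hw)) R
  obtain ⟨D, hD0, hD⟩ := exists_bound_of_continuous (Finset.range (N + 1))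
    (φ := fun j => (fun x => ‖iteratedFDeriv ℝ j f x‖))
    (fun j hj => (hfN.continuous_iteratedFDeriv
      (by exact_mod_cast Nat.lt_succ_iff.mp (Finset.mem_range.mp hj))).norm) R
  obtain ⟨C₁, hC₁0, hC₁⟩ := hf.exists_taylor_bound hN R
  choose C₂ hC₂0 hC₂ using exists_expansion_prod_bound hV hM0 hB hH
  -- Bounds both the centred coordinates of `y` and their expansions, for the comparison of
  -- products.
  set K : ℝ := max 1 (max (2 * R) ((words ℓ N).card * (B * H ^ N * M))) with hK
  have hK1 : 1 ≤ K := le_max_left _ _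
  have hcard : ∀ j : ℕ, 0 ≤ C₂ j + j * K ^ j := fun j => add_nonneg (hC₂0 j) (by positivity)
  set S : ℝ := ∑ j ∈ Finset.range (N + 1), ∑ _r : Fin j → Fin d, D * (C₂ j + j * K ^ j) with hS
  have hS0 : 0 ≤ S := Finset.sum_nonneg fun j _ => Finset.sum_nonneg fun _ _ =>
    mul_nonneg hD0 (hcard j)
  refine ⟨C₁ + S, by positivity, fun x y a h ε hx hy hgl h0 hh ha hε => ?_⟩
  have hε0 : 0 ≤ ε := (norm_nonneg _).trans hε
  have hqC : ∀ i : Fin d, ContDiff ℝ N (fun y : EuclideanSpace ℝ (Fin d) => y i - x i) :=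
    fun i => by fun_prop
  have hqM : ∀ i : Fin d, ∀ w : List (Fin ℓ), w.length ≤ N →
      |diffOp V w (fun y : EuclideanSpace ℝ (Fin d) => y i - x i) x| ≤ M := fun i w hw =>
    (abs_diffOp_centered_coordinate_le hV x i hw).trans (hM w (mem_words.mpr hw) x hx)
  -- Replacing each factor of the monomial by its expansion costs `ε`; moving the expansion outside
  -- the product costs `h ^ (N + 1)`.
  have hterm : ∀ (j : ℕ) (r : Fin j → Fin d),
      |∏ m, (y (r m) - x (r m)) -
        expansion V a (fun y : EuclideanSpace ℝ (Fin d) => ∏ m, (y (r m) - x (r m))) x| ≤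
      (C₂ j + j * K ^ j) * (h ^ (N + 1) + ε) := by
    intro j r
    have h1 := (hC₂ j (fun m y => y (r m) - x (r m)) x (fun m => hqC (r m))
      fun m => hqM (r m)).2 a h hgl h0 hh ha
    have h2 := abs_prod_sub_prod_le (b := fun m : Fin j => y (r m) - x (r m))
      (c := fun m => expansion V a (fun y : EuclideanSpace ℝ (Fin d) => y (r m) - x (r m)) x)
      hK1 (fun m => ?_) (fun m => ?_) (fun m => ?_) hε0
    · rw [abs_sub_comm] at h1
      refine (abs_sub_le _ _ _).trans ((add_le_add h2 h1).trans ?_)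
      have h3 : 0 ≤ C₂ j * ε := mul_nonneg (hC₂0 j) hε0
      have h4 : 0 ≤ (j * K ^ j) * h ^ (N + 1) := by positivity
      linarith
    · have h3 : |y (r m) - x (r m)| ≤ ‖y - x‖ := PiLp.norm_apply_le (y - x) (r m)
      have h4 := norm_sub_le y x
      have h5 : 2 * R ≤ K := (le_max_left _ _).trans (le_max_right _ _)
      linarith
    · exact (abs_expansion_le hB hH h0 hh ha (hqM (r m))).trans
        ((le_max_right _ _).trans (le_max_right _ _))
    · rw [expansion_centered_coordinate hV hgl.coeff_nil]
      have h3 := PiLp.norm_apply_le (y - (x + taylorSum V a (fun y => y) x)) (r m)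
      have e : y (r m) - x (r m) - ((x + taylorSum V a (fun y => y) x) (r m) - x (r m)) =
          (y - (x + taylorSum V a (fun y => y) x)) (r m) := by
        rw [PiLp.sub_apply]
        ring
      rw [e]
      exact h3.trans hε
  set c : (j : ℕ) → (Fin j → Fin d) → ℝ := fun j r => (j.factorial : ℝ)⁻¹ *
    iteratedFDeriv ℝ j f x (fun m => EuclideanSpace.basisFun (Fin d) ℝ (r m)) with hc
  have hcD : ∀ j ∈ Finset.range (N + 1), ∀ r : Fin j → Fin d, |c j r| ≤ D := by
    intro j hj r
    have h1 := (iteratedFDeriv ℝ j f x).le_opNorm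
      (fun m => EuclideanSpace.basisFun (Fin d) ℝ (r m))
    have h2 : ∏ m, ‖EuclideanSpace.basisFun (Fin d) ℝ (r m)‖ = 1 :=
      Finset.prod_eq_one fun m _ => (EuclideanSpace.basisFun (Fin d) ℝ).norm_eq_one _
    rw [h2, mul_one, Real.norm_eq_abs] at h1
    have h3 : ((j.factorial : ℝ)⁻¹) ≤ 1 :=
      inv_le_one_of_one_le₀ (by exact_mod_cast Nat.one_le_iff_ne_zero.mpr j.factorial_ne_zero)
    have h4 := hD j hj x hx
    rw [norm_norm] at h4
    rw [hc, abs_mul, abs_of_nonneg (by positivity : (0 : ℝ) ≤ (j.factorial : ℝ)⁻¹)]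
    calc _ ≤ 1 * D := mul_le_mul h3 (h1.trans h4) (abs_nonneg _) zero_le_one
      _ = D := one_mul D
  have hexp : expansion V a f x = ∑ j ∈ Finset.range (N + 1), ∑ r : Fin j → Fin d, c j r *
      expansion V a (fun y : EuclideanSpace ℝ (Fin d) => ∏ m, (y (r m) - x (r m))) x := by
    rw [← expansion_taylorPolynomial hV hfN, funext (taylorPolynomial_eq_sum_prod N f x),
      expansion_sum hV _ fun j _ => ContDiff.sum fun r _ => contDiff_const.mul
        (contDiff_prod fun m _ => hqC (r m))]
    refine Finset.sum_congr rfl fun j _ => ?_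
    rw [expansion_sum hV _ fun r _ => contDiff_const.mul (contDiff_prod fun m _ => hqC (r m))]
    refine Finset.sum_congr rfl fun r _ => ?_
    exact expansion_clm_comp hV
      (g := fun y : EuclideanSpace ℝ (Fin d) => ∏ m, (y (r m) - x (r m)))
      (contDiff_prod fun m _ => hqC (r m))
      (c j r • ContinuousLinearMap.id ℝ ℝ) a x
  have hpoly : |taylorPolynomial N f x y - expansion V a f x| ≤ S * (h ^ (N + 1) + ε) := by
    rw [taylorPolynomial_eq_sum_prod, hexp, ← Finset.sum_sub_distrib, hS, Finset.sum_mul]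
    refine (Finset.abs_sum_le_sum_abs _ _).trans (Finset.sum_le_sum fun j hj => ?_)
    rw [← Finset.sum_sub_distrib, Finset.sum_mul]
    refine (Finset.abs_sum_le_sum_abs _ _).trans (Finset.sum_le_sum fun r _ => ?_)
    rw [← mul_sub, abs_mul, mul_assoc]
    exact mul_le_mul (hcD j hj r) (hterm j r) (abs_nonneg _) hD0
  have htaylor := hC₁ x y hx hy
  rw [Real.norm_eq_abs] at htaylor
  refine (abs_sub_le _ _ _).trans ((add_le_add htaylor hpoly).trans ?_)
  have h1 : 0 ≤ C₁ * (h ^ (N + 1) + ε) := by positivity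
  have h2 : 0 ≤ S * (‖y - x‖ ^ min (γ - N) 1 * ‖y - x‖ ^ N) := by positivity
  linarith

end Core

/-! ### Equivalence of the two notions of solution -/

section Equivalence

variable {d ℓ : ℕ} {p γ T : ℝ}
  {V : Fin ℓ → EuclideanSpace ℝ (Fin d) → EuclideanSpace ℝ (Fin d)}
  {X : ℝ → (TruncTensor ℓ ⌊p⌋₊)ˣ} {z : ℝ → EuclideanSpace ℝ (Fin d)}

theorem IsWeakGeometricRoughPath.isGroupLike_incr (hX : IsWeakGeometricRoughPath p T X) {s t : ℝ}
    (hs : 0 ≤ s) (hst : s ≤ t) (ht : t ≤ T) : IsGroupLike (incr X s t) := by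
  rw [incr, Units.val_mul]
  exact (IsGroupLike.of_mem (hX.1 s ⟨hs, hst.trans ht⟩)).inv.mul
    (IsGroupLike.of_mem (hX.1 t ⟨hs.trans hst, ht⟩))

theorem IsWeakGeometricRoughPath.exists_coeff_bound (hX : IsWeakGeometricRoughPath p T X) :
    ∃ B : ℝ, 0 ≤ B ∧ ∀ s t : ℝ, 0 ≤ s → s ≤ t → t ≤ T → ∀ w,
      |(incr X s t).coeff w| ≤ B * (|t - s| ^ (1 / p)) ^ w.length := by
  obtain ⟨C, hC⟩ := hX.2
  refine ⟨max 1 C ^ ⌊p⌋₊, by positivity, fun s t hs hst ht w => ?_⟩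
  refine abs_coeff_le_of_homNorm_le (hX.isGroupLike_incr hs hst ht).coeff_nil (le_max_left _ _)
    (by positivity) ((hC s t hs hst ht).trans ?_) w
  exact mul_le_mul_of_nonneg_right (le_max_right _ _) (by positivity)

theorem IsDavieSolution.isBailleulSolution (hp : 1 ≤ p) (hγ : p < γ) (hT : 0 ≤ T)
    (hV : ∀ i, IsClassC γ (V i)) (hX : IsWeakGeometricRoughPath p T X)
    (hz : IsDavieSolution p T V X z) : IsBailleulSolution p γ T V X z := by
  obtain ⟨a, ha1, C, hC⟩ := hz
  obtain ⟨B, hB0, hB⟩ := hX.exists_coeff_bound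
  have hp0 : 0 < p := by linarith
  have hNp : (⌊p⌋₊ : ℝ) ≤ p := Nat.floor_le hp0.le
  have hpN : p < (⌊p⌋₊ : ℝ) + 1 := Nat.lt_floor_add_one p
  have hNγ : (⌊p⌋₊ : ℝ) < γ := hNp.trans_lt hγ
  have hVN : ∀ i, ContDiff ℝ ⌊p⌋₊ (V i) := fun i => (hV i).contDiff_of_lt hNγ
  have hinv : 1 / p ≤ 1 := (div_le_one hp0).mpr hp
  have hinv0 : 0 < 1 / p := by positivity
  set H : ℝ := max 1 (T ^ (1 / p)) with hH
  have hH1 : 1 ≤ H := le_max_left _ _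
  have hu : ∀ {s t : ℝ}, 0 ≤ s → s ≤ t → t ≤ T → |t - s| ≤ T := fun hs hst ht => by
    rw [abs_of_nonneg (by linarith)]
    linarith
  have hhH : ∀ {s t : ℝ}, 0 ≤ s → s ≤ t → t ≤ T → |t - s| ^ (1 / p) ≤ H := fun hs hst ht =>
    (Real.rpow_le_rpow (abs_nonneg _) (hu hs hst ht) hinv0.le).trans (le_max_right _ _)
  have hCu : ∀ {s t : ℝ}, 0 ≤ s → s ≤ t → t ≤ T → C * |t - s| ^ a ≤
      max C 0 * T ^ (a - 1 / p) * |t - s| ^ (1 / p) := fun {s t} hs hst ht => by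
    rw [mul_assoc]
    exact (mul_le_mul_of_nonneg_right (le_max_left C 0) (by positivity)).trans
      (mul_le_mul_of_nonneg_left (rpow_le_mul_rpow (abs_nonneg _) (hu hs hst ht) hinv0
        (by linarith)) (le_max_right C 0))
  -- Used twice: from `s = 0` it bounds `z` on the whole interval, and that bound then gives a
  -- Hölder estimate uniform in `s`.
  have hlip : ∀ R : ℝ, ∃ D : ℝ, 0 ≤ D ∧ ∀ s t : ℝ, 0 ≤ s → s ≤ t → t ≤ T → ‖z s‖ ≤ R →
      ‖z t - z s‖ ≤ D * |t - s| ^ (1 / p) := by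
    intro R
    obtain ⟨M, hM0, hM⟩ := exists_bound_of_continuous (words ℓ ⌊p⌋₊)
      (φ := fun w => diffOp V w (fun y : EuclideanSpace ℝ (Fin d) => y))
      (fun w hw => continuous_diffOp hVN contDiff_id (mem_words.mp hw)) R
    refine ⟨(∑ k ∈ Finset.Icc 1 ⌊p⌋₊, ∑ _I : Fin k → Fin ℓ, B * H ^ ⌊p⌋₊ * M) +
      max C 0 * T ^ (a - 1 / p), ?_, fun s t hs hst ht hzs => ?_⟩
    · have h1 : 0 ≤ ∑ k ∈ Finset.Icc 1 ⌊p⌋₊, ∑ _I : Fin k → Fin ℓ, B * H ^ ⌊p⌋₊ * M :=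
        Finset.sum_nonneg fun _ _ => Finset.sum_nonneg fun _ _ => by positivity
      positivity
    · have h1 := norm_taylorSum_le (V := V) (g := fun y => y) (x := z s) hB0 hH1
        (by positivity : 0 ≤ |t - s| ^ (1 / p)) (hhH hs hst ht) (hB s t hs hst ht)
        fun w hw => hM w (mem_words.mpr hw) _ hzs
      have h2 := (hC s t hs hst ht).trans (hCu hs hst ht)
      have e : z t - z s = (z t - (z s + taylorSum V (incr X s t) (fun x => x) (z s))) +
          taylorSum V (incr X s t) (fun x => x) (z s) := by abel
      rw [e, add_mul, add_comm (_ * _)]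
      exact (norm_add_le _ _).trans (add_le_add h2 h1)
  obtain ⟨D₀, hD₀0, hD₀⟩ := hlip ‖z 0‖
  set R : ℝ := ‖z 0‖ + D₀ * H with hR
  have hzR : ∀ t, 0 ≤ t → t ≤ T → ‖z t‖ ≤ R := by
    intro t h0 ht
    have h1 := hD₀ 0 t le_rfl h0 ht le_rfl
    have h2 := mul_le_mul_of_nonneg_left (hhH le_rfl h0 ht) hD₀0
    calc ‖z t‖ = ‖z 0 + (z t - z 0)‖ := by rw [add_sub_cancel]
      _ ≤ R := (norm_add_le _ _).trans (by linarith)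
  obtain ⟨D, hD0, hD⟩ := hlip R
  set β : ℝ := min (γ - ⌊p⌋₊) 1 with hβ
  have hβ0 : 0 < β := lt_min (by linarith) one_pos
  have hβ1 : β ≤ 1 := min_le_right _ _
  have hpβ : p < ⌊p⌋₊ + β := by
    rcases min_choice (γ - ⌊p⌋₊) 1 with h | h <;> rw [hβ, h] <;> linarith
  -- The worst of the three error exponents, since `(N + β) / p ≤ (N + 1) / p`. It does not involve
  -- `f`.
  set b : ℝ := min a ((⌊p⌋₊ + β) / p) with hb
  have hb1 : 1 < b := lt_min ha1 ((one_lt_div hp0).mpr hpβ)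
  have hb0 : 0 < b := by linarith
  have hbβ : b ≤ (⌊p⌋₊ + β) / p := min_le_right _ _
  have hbN : b ≤ (⌊p⌋₊ + 1) / p := hbβ.trans (by gcongr)
  refine ⟨b, hb1, fun f hf => ?_⟩
  obtain ⟨A, hA0, hA⟩ := exists_expansion_bound hVN hNγ hf hB0 hH1
  refine ⟨A * (D ^ β * D ^ ⌊p⌋₊ * T ^ ((⌊p⌋₊ + β) / p - b) + (T ^ ((⌊p⌋₊ + 1) / p - b) +
    max C 0 * T ^ (a - b))), fun s t hs hst ht => ?_⟩
  have hgl := hX.isGroupLike_incr hs hst ht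
  have hh0 : 0 ≤ |t - s| ^ (1 / p) := by positivity
  have hzs := hzR s hs (hst.trans ht)
  have hmain := hA (z s) (z t) (incr X s t) (|t - s| ^ (1 / p)) (C * |t - s| ^ a) hzs
    (hzR t (hs.trans hst) ht) hgl hh0 (hhH hs hst ht) (hB s t hs hst ht) (hC s t hs hst ht)
  rw [expansion_eq hgl.coeff_nil] at hmain
  refine hmain.trans ?_
  rw [mul_assoc]
  refine mul_le_mul_of_nonneg_left ?_ hA0
  rw [add_mul, add_mul]
  have hpow : ∀ c : ℝ, (|t - s| ^ (1 / p)) ^ c = |t - s| ^ (c / p) := fun c => by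
    rw [← Real.rpow_mul (abs_nonneg _), one_div_mul_eq_div]
  refine add_le_add ?_ (add_le_add ?_ ?_)
  · have h1 := hD s t hs hst ht hzs
    have h2 : ‖z t - z s‖ ^ β ≤ (D * |t - s| ^ (1 / p)) ^ β :=
      Real.rpow_le_rpow (norm_nonneg _) h1 hβ0.le
    have h3 : ‖z t - z s‖ ^ ⌊p⌋₊ ≤ (D * |t - s| ^ (1 / p)) ^ ⌊p⌋₊ :=
      pow_le_pow_left₀ (norm_nonneg _) h1 _
    rw [Real.mul_rpow hD0 hh0] at h2
    rw [mul_pow] at h3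
    have h4 : (|t - s| ^ (1 / p)) ^ β * (|t - s| ^ (1 / p)) ^ ⌊p⌋₊ =
        |t - s| ^ ((⌊p⌋₊ + β) / p) := by
      rw [← Real.rpow_natCast, ← Real.rpow_add_of_nonneg hh0 hβ0.le (Nat.cast_nonneg _), hpow,
        add_comm β]
    calc ‖z t - z s‖ ^ β * ‖z t - z s‖ ^ ⌊p⌋₊
        ≤ (D ^ β * (|t - s| ^ (1 / p)) ^ β) * (D ^ ⌊p⌋₊ * (|t - s| ^ (1 / p)) ^ ⌊p⌋₊) :=
          mul_le_mul h2 h3 (by positivity) (by positivity)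
      _ = D ^ β * D ^ ⌊p⌋₊ * |t - s| ^ ((⌊p⌋₊ + β) / p) := by rw [← h4]; ring
      _ ≤ D ^ β * D ^ ⌊p⌋₊ * (T ^ ((⌊p⌋₊ + β) / p - b) * |t - s| ^ b) :=
          mul_le_mul_of_nonneg_left (rpow_le_mul_rpow (abs_nonneg _) (hu hs hst ht) hb0 hbβ)
            (by positivity)
      _ = _ := by ring
  · have h1 := hpow ((⌊p⌋₊ + 1 : ℕ) : ℝ)
    rw [Real.rpow_natCast] at h1
    rw [h1]
    push_cast
    exact rpow_le_mul_rpow (abs_nonneg _) (hu hs hst ht) hb0 hbN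
  · rw [mul_assoc]
    exact (mul_le_mul_of_nonneg_right (le_max_left C 0) (by positivity)).trans
      (mul_le_mul_of_nonneg_left (rpow_le_mul_rpow (abs_nonneg _) (hu hs hst ht) hb0
        (min_le_left _ _)) (le_max_right C 0))

/-- Expansions commute with linear maps, so testing on the coordinates gives the components of the
Davie remainder, with the same exponent. -/
theorem IsBailleulSolution.isDavieSolution (hp : 1 ≤ p) (hγ : p < γ)
    (hV : ∀ i, IsClassC γ (V i)) (hX : IsWeakGeometricRoughPath p T X)
    (hz : IsBailleulSolution p γ T V X z) : IsDavieSolution p T V X z := by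
  obtain ⟨a, ha1, hz⟩ := hz
  have hp0 : 0 < p := by linarith
  have hVN : ∀ i, ContDiff ℝ ⌊p⌋₊ (V i) := fun i =>
    (hV i).contDiff_of_lt ((Nat.floor_le hp0.le).trans_lt hγ)
  have hcoord : ∀ i : Fin d, IsClassC γ (fun y : EuclideanSpace ℝ (Fin d) => y i) := fun i =>
    isClassC_of_contDiff (by linarith) fun n => by fun_prop
  choose C hC using fun i => hz _ (hcoord i)
  refine ⟨a, ha1, ∑ i, C i, fun s t hs hst ht => ?_⟩
  have hgl := hX.isGroupLike_incr hs hst ht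
  set v := z t - (z s + taylorSum V (incr X s t) (fun x => x) (z s)) with hv
  have hvi : ∀ i, |v i| ≤ C i * |t - s| ^ a := by
    intro i
    have h := hC i s t hs hst ht
    rw [← expansion_eq hgl.coeff_nil (fun y : EuclideanSpace ℝ (Fin d) => y i),
      expansion_coordinate hVN hgl.coeff_nil] at h
    rw [hv, PiLp.sub_apply]
    exact h
  have hsum : v = ∑ i, v i • EuclideanSpace.basisFun (Fin d) ℝ i := by
    have := (EuclideanSpace.basisFun (Fin d) ℝ).sum_repr v
    simpa using this.symm
  rw [hsum, Finset.sum_mul]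
  refine norm_sum_le_of_le _ fun i _ => ?_
  rw [norm_smul, (EuclideanSpace.basisFun (Fin d) ℝ).norm_eq_one, mul_one, Real.norm_eq_abs]
  exact hvi i

end Equivalence

end RoughPaths

end

theorem theorem1 {d ℓ : ℕ} {p γ T : ℝ} (hp : 1 ≤ p) (hγ : p < γ) (hT : 0 ≤ T)
    (V : Fin ℓ → EuclideanSpace ℝ (Fin d) → EuclideanSpace ℝ (Fin d))
    (hV : ∀ i, RoughPaths.IsClassC γ (V i))
    (X : ℝ → (RoughPaths.TruncTensor ℓ ⌊p⌋₊)ˣ)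
    (hX : RoughPaths.IsWeakGeometricRoughPath p T X)
    (z : ℝ → EuclideanSpace ℝ (Fin d)) :
    RoughPaths.IsDavieSolution p T V X z ↔ RoughPaths.IsBailleulSolution p γ T V X z :=
  ⟨fun h => h.isBailleulSolution hp hγ hT hV hX, fun h => h.isDavieSolution hp hγ hV hX⟩
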